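/- Setting. Let $r\ge t-1\ge 1$ be integers and let $n_1\ge\dots\ge n_r\ge 0$ be integers. Let $G$ be a graph whose vertex set is partitioned into $\mathcal V=(V_1,\dots,V_r)$ with $|V_i|=n_i$ such that every edge of $G$ joins two different $V_i$'s, i.e. $G$ is a spanning subgraph of the complete $r$-partite graph $K=K_{n_1,\dots,n_r}$ with parts $V_1,\dots,V_r$. Put $$f(n_1,\dots,n_r,1,t)=\max_{\mathcal I}\ \sum_{\{I,I'\}\subseteq\mathcal I,\ I\ne I'}\Big(\sum_{i\in I}n_i\Big)\Big(\sum_{i\in I'}n_i\Big),$$ where $\mathcal I$ runs over all partitions of $\{1,\dots,r\}$ into $t-1$ nonempty classes and the sum is over unordered pairs. Stability. Let $\mathcal A=(A_1,\dots,A_r)$ and $\mathcal P=(P_1,\dots,P_s)$ be two families of pairwise disjoint sets with the same union. The classes of $\mathcal A$ are its nonempty members. A class $A_i$ is integral in $P_j$ if $A_i\subseteq P_j$, and partial in $P_j$ if $A_i\cap P_j\ne\emptyset$ and $A_i\not\subseteq P_j$. The integral part of $P_j$ is the union of the classes $A_i$ that are integral in $P_j$. $P_j$ is a partial class if some $A_i$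 is partial in it, and an integral class otherwise. $\mathcal P$ is stable to $\mathcal A$ if 1. for each $j$ at most one $A_i$ is partial in $P_j$; 2. the integral parts of all partial classes of $\mathcal P$ have the same size, and this size is at most the size of every integral class of $\mathcal P$; 3. the integral part of every $P_j$ is at least as large as every $A_i$ that is partial in some class of $\mathcal P$; 4. if $A_i$ is integral in $P_j$ and $j'\ne j$, then $|P_j\setminus A_i|$ is at most the size of the integral part of $P_{j'}$. For a vertex set $X$ write $\mathcal V_X=(V_1\setminus X,\dots,V_r\setminus X)$ and $\mathcal P_X=(P_1\setminus X,\dots,P_{t-1}\setminus X)$. For a partition $\mathcal P=(P_1,\dots,P_{t-1})$ of $V(G)$, let $K[\mathcal P]$ consist of the edges of $K$ that join different classes of $\mathcal P$. $\mathcal P$ is an $(X,\epsilon)$-stable $(t-1)$-partition of $G$ if $|X|\le\epsilon n_{t-1}$, every vertex $v\notin X$ satisfies $|N_{G-X}(v)\,\triangle\,N_{K[\mathcal P]-X}(v)|\le\epsilon n_{t-1}$, and $\mathcal P_X$ is stable to $\mathcal V_X$. Theorem. For all integers $t\ge 2$ and $r\ge t-1$ and every $0<\epsilon<1$ there exists $\delta>0$,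 depending only on $t$, $r$ and $\epsilon$, such that the following holds for all $n_1\ge\dots\ge n_r$ and every $G$ as above. If $G$ is $K_t$-free, $n_{t-1}\ge 1/\delta$ and $$e(G)\ge f(n_1,\dots,n_r,1,t)-\delta n_{t-1}^2,$$ then there are a vertex set $X$ and an $(X,\epsilon)$-stable $(t-1)$-partition $\mathcal P$ of $G$ such that, moreover, the integral part (with respect to $\mathcal V_X$) of each class of $\mathcal P_X$ has size larger than $(1-\epsilon)n_{t-1}$. -/

import Mathlib

namespace MultipartiteStability

/-- The class of the vertices with label `i`.  A labelled partition `(V_1, …, V_r)` of a finite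
vertex set `W` is encoded by the map `c : W → Fin r` that sends a vertex to the index of its
class (classes are numbered from `0`). -/
def cls {W ι : Type*} [Fintype W] [DecidableEq ι] (c : W → ι) (i : ι) : Finset W :=
  Finset.univ.filter fun v => c v = i

/-- The complete multipartite graph whose parts are the classes of `c`. -/
def completeParts {W ι : Type*} (c : W → ι) : SimpleGraph W where
  Adj u v := c u ≠ c v
  symm := ⟨fun _ _ h => Ne.symm h⟩
  loopless := ⟨fun _ h => h rfl⟩

/-- `H[p]`: the graph of those edges of `H` whose ends lie in different classes of `p`. -/
def restrictToParts {W κ : Type*} (H : SimpleGraph W) (p : W → κ) : SimpleGraph W :=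
  H ⊓ completeParts p

/-- The value of one partition of the index set `[r]` into `s` labelled classes, encoded by
`q : Fin r → Fin s`: the sum of `n_I * n_{I'}` over unordered pairs of distinct classes `I`, `I'`,
where `n_I` is the sum of the `n i` with `i ∈ I`. -/
def crossSum {r s : ℕ} (n : Fin r → ℕ) (q : Fin r → Fin s) : ℕ :=
  ∑ j : Fin s, ∑ j' ∈ Finset.Ioi j, (∑ i ∈ cls q j, n i) * (∑ i ∈ cls q j', n i)

/-- `f(n_1, …, n_r, 1, t)`: the maximum of `crossSum n q` over all partitions `q` of `[r]` into
`t - 1` nonempty classes. -/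
def f {r : ℕ} (n : Fin r → ℕ) (t : ℕ) : ℕ :=
  (Finset.univ.filter fun q : Fin r → Fin (t - 1) => Function.Surjective q).sup (crossSum n)

section Families

variable {W ι κ : Type*} [DecidableEq W] [Fintype ι]

/-- `𝒜 i` is a (nonempty) class of `𝒜` contained in the class `ℬ j` of `ℬ`.  Empty members of the
family `𝒜` do not count as classes: they occur when a set of vertices is
removed and swallows a class. -/
def IsIntegralIn (𝒜 : ι → Finset W) (ℬ : κ → Finset W) (i : ι) (j : κ) : Prop :=
  (𝒜 i).Nonempty ∧ 𝒜 i ⊆ ℬ j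

/-- `𝒜 i` meets `ℬ j` but is not contained in it. -/
def IsPartialIn (𝒜 : ι → Finset W) (ℬ : κ → Finset W) (i : ι) (j : κ) : Prop :=
  (𝒜 i ∩ ℬ j).Nonempty ∧ ¬ 𝒜 i ⊆ ℬ j

open Classical in
/-- The integral part of `ℬ j`: the union of the `𝒜 i` that are integral in `ℬ j`. -/
noncomputable def integralPart (𝒜 : ι → Finset W) (ℬ : κ → Finset W) (j : κ) : Finset W :=
  (Finset.univ.filter fun i => IsIntegralIn 𝒜 ℬ i j).biUnion 𝒜

/-- `ℬ j` is a partial class of `ℬ`, i.e. its partial part is nonempty; otherwise `ℬ j` is an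
integral class. -/
def IsPartialClass (𝒜 : ι → Finset W) (ℬ : κ → Finset W) (j : κ) : Prop :=
  ∃ i, IsPartialIn 𝒜 ℬ i j

/-- `ℬ` is stable to `𝒜`. -/
structure IsStable (𝒜 : ι → Finset W) (ℬ : κ → Finset W) : Prop where
  /-- `ℬ` is 1-partial: every class contains at most one partial `𝒜 i`. -/
  one_partial : ∀ j i i', IsPartialIn 𝒜 ℬ i j → IsPartialIn 𝒜 ℬ i' j → i = i'
  /-- The integral parts of the partial classes of `ℬ` have equal sizes … -/
  partial_eq : ∀ j j', IsPartialClass 𝒜 ℬ j → IsPartialClass 𝒜 ℬ j' →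
    (integralPart 𝒜 ℬ j).card = (integralPart 𝒜 ℬ j').card
  /-- … and these are at most the size of every integral class of `ℬ`. -/
  partial_le : ∀ j j', IsPartialClass 𝒜 ℬ j → ¬ IsPartialClass 𝒜 ℬ j' →
    (integralPart 𝒜 ℬ j).card ≤ (ℬ j').card
  /-- The integral part of every class of `ℬ` is at least as large as every partial `𝒜 i`. -/
  card_partial_le : ∀ i k j, IsPartialIn 𝒜 ℬ i k → (𝒜 i).card ≤ (integralPart 𝒜 ℬ j).card
  /-- Removing an integral `𝒜 i` from its class leaves a set that is at most as large as the
  integral part of every other class. -/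
  card_sdiff_le : ∀ i j j', IsIntegralIn 𝒜 ℬ i j → j' ≠ j →
    (ℬ j \ 𝒜 i).card ≤ (integralPart 𝒜 ℬ j').card

end Families

/-- Two graphs on the same vertex set are `α`-close if the neighbourhoods of every vertex differ
in at most `α` vertices. -/
def IsClose {U : Type*} (α : ℝ) (G H : SimpleGraph U) : Prop :=
  ∀ v, ((symmDiff (G.neighborSet v) (H.neighborSet v)).ncard : ℝ) ≤ α

/-- The family of the classes of `c` with the vertices of `X` removed. -/
def clsOff {W ι : Type*} [Fintype W] [DecidableEq W] [DecidableEq ι] (c : W → ι) (X : Finset W)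
    (i : ι) : Finset W :=
  cls c i \ X

/-- For a spanning subgraph `G` of the complete multipartite graph `K` with parts `c`, the
partition `p` is `(X, ε)`-stable, where `m` is the size `n_{t-1}`: `|X| ≤ ε m`, the graph `G - X`
is `ε m`-close to `K[p] - X`, and `p_X` is stable to `c_X`. -/
structure IsXStable {W ι κ : Type*} [Fintype W] [DecidableEq W] [Fintype ι] [DecidableEq ι]
    [DecidableEq κ] (G : SimpleGraph W) (c : W → ι) (p : W → κ) (X : Finset W) (ε : ℝ)
    (m : ℕ) : Prop where
  card_le : (X.card : ℝ) ≤ ε * m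
  close : IsClose (ε * m) (G.induce ((X : Set W)ᶜ))
    ((restrictToParts (completeParts c) p).induce ((X : Set W)ᶜ))
  stable : IsStable (clsOff c X) (clsOff p X)

end MultipartiteStability

/-!
Write `k = t - 1`, let `m` be the `k`-th largest part size, and double all edge counts, so that the
complete multipartite graph on weighted vertices with classes `q` counts `(∑ b) ^ 2` minus the sum
`sqWeight` of the squared class weights.

**Transversals.** Choose one vertex `u i` in each part uniformly at random. The graph induced on the
`r` chosen vertices is `K_{k+1}`-free, and if the vertex `i` has weight `n i`, its expected weight is
the number of edges of `G` (`sum_edgeWeight_comap`). By the weighted form of Turán's theorem no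
transversal exceeds the maximum, so on average it falls short of the maximum by at most
`2 * δ * m ^ 2`: the parts may be far larger than `m`, but the problem has been moved to graphs on a
fixed set of `r` vertices.
Füredi's proof of stability gives more (`exists_partition_of_cliqueFree`): a
`K_{k+1}`-free weighted graph has a `k`-partition such that each single pair on which it differs from
the complete multipartite graph weighs at most this shortfall, the `defect`.

**A gap in the part sizes.** Pigeonholing over `r + 1` scales (`exists_gap`) yields `α` such that no
part size is between `α' * m` and `α * m`, where `α'` is tiny compared to `α`. The parts below
`α' * m` are given weight `0`, which hardly changes the defect (`defect_le_of_restrict`), and are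
deleted in the end; among the others, a transversal of defect below
`(α * m) ^ 2` induces *exactly* a complete multipartite graph, and its partition is near-optimal.

**Labelling the vertices** (`exists_vertex_labelling`). Fix a transversal `u` such that it and its
replacements in one or two places have small defect on average. Replacing `u i` by a typical vertex
`v` of the part `i` keeps the graph complete multipartite, and the class of `i` in it is the label
of `v`. Replacing two entries shows that two typical vertices are adjacent exactly if their labels
differ. Parts much larger than `m` are alone in their class in every near-optimal partition, so that
each missing edge at such a part costs its full weight, which keeps the exceptional sets small
compared to `m`.

**Stability.** The replacements also show that the partition of the parts stays near-optimal when one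
or two parts are moved to other classes that occur on them. Comparing these partitions
with each other and with few others gives the conditions of stability up to an error that is small
compared to `α * m` (the lemmas on `IsSwapOpt`). Finally `exists_isStable_of_almost` turns
approximate into exact stability by deleting a few more vertices.
-/

namespace MultipartiteStability

open Finset

/-! ### Weighted Turán problems on a fixed vertex set -/

section WeightedTuran

variable {ι : Type*} {k : ℕ}

/-- The weight of the class `j` of the partition `q`, for the vertex weights `b`. -/
def classWeight [Fintype ι] (b : ι → ℝ) (q : ι → Fin k) (j : Fin k) : ℝ :=
  ∑ i, if q i = j then b i else 0

/-- The sum of the squared class weights.  Up to the constant `(∑ i, b i) ^ 2` this is minus twice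
the weight of the complete multipartite graph with classes `q`, so that optimal partitions are the
minimizers of `sqWeight`. -/
def sqWeight [Fintype ι] (b : ι → ℝ) (q : ι → Fin k) : ℝ := ∑ j, classWeight b q j ^ 2

open Classical in
/-- Twice the weight of the edges of `H`, where the edge `il` weighs `b i * b l`: the sum runs over
ordered pairs. -/
noncomputable def edgeWeight [Fintype ι] (b : ι → ℝ) (H : SimpleGraph ι) : ℝ :=
  ∑ i, ∑ l, if H.Adj i l then b i * b l else 0

theorem sqWeight_eq_sum [Fintype ι] (b : ι → ℝ) (q : ι → Fin k) :
    sqWeight b q = ∑ i, ∑ l, if q i = q l then b i * b l else 0 := by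
  simp only [sqWeight, classWeight, sq, Finset.sum_mul_sum]
  rw [Finset.sum_comm]
  refine Finset.sum_congr rfl fun i _ => ?_
  rw [Finset.sum_comm]
  refine Finset.sum_congr rfl fun l _ => ?_
  rw [Finset.sum_eq_single (q i)]
  · simp only [if_true, mul_ite, mul_zero, eq_comm]
  · intro j _ hj
    simp [Ne.symm hj]
  · simp

open Classical in
/-- Füredi's argument: the non-neighbours of a vertex of maximum weighted degree form one class, and
the neighbours are treated recursively. Every edge inside a class is counted twice. -/
theorem exists_partition_of_cliqueFreeOn (b : ι → ℝ) (hb : ∀ i, 0 ≤ b i) (H : SimpleGraph ι) :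
    ∀ (k : ℕ) (S : Finset ι), H.CliqueFreeOn S (k + 1) → ∃ q : ι → ℕ, (∀ i ∈ S, q i < k) ∧
      ∑ i ∈ S, ∑ l ∈ S, b i * b l * ((if H.Adj i l then 1 else 0) +
        (if H.Adj i l ∧ q i = q l then 1 else 0) - (if q i = q l then 0 else 1)) ≤ 0 := by
  intro k
  induction k with
  | zero =>
    intro S hS
    have hS0 : S = ∅ := by
      by_contra h
      obtain ⟨x, hx⟩ := Finset.nonempty_iff_ne_empty.2 h
      exact hS (t := {x}) (by simpa using hx) (SimpleGraph.isNClique_singleton.2 rfl)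
    exact ⟨fun _ => 0, by simp [hS0], by simp [hS0]⟩
  | succ k ih =>
    intro S hS
    rcases S.eq_empty_or_nonempty with rfl | hne
    · exact ⟨fun _ => 0, by simp, by simp⟩
    obtain ⟨x, hx, hmax⟩ := Finset.exists_max_image S
      (fun v => ∑ l ∈ S, b l * (if H.Adj v l then 1 else 0)) hne
    set N := S.filter fun v => H.Adj x v with hN
    set A := S.filter fun v => ¬ H.Adj x v with hA
    have hNfree : H.CliqueFreeOn N (k + 1) := by
      intro t ht hcl
      have hxt : ∀ v ∈ t, H.Adj x v := fun v hv => by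
        have := ht hv
        rw [hN] at this
        simp only [coe_filter, Set.mem_ofPred_eq] at this
        exact this.2
      refine hS (t := insert x t) ?_ (hcl.insert hxt)
      intro v hv
      rcases Finset.mem_insert.1 (Finset.mem_coe.1 hv) with rfl | hv
      · exact hx
      · exact Finset.filter_subset _ _ (ht hv)
    obtain ⟨q, hqk, hq⟩ := ih N hNfree
    refine ⟨fun i => if H.Adj x i then q i else k, ?_, ?_⟩
    · intro i hi
      by_cases h : H.Adj x i
      · have := hqk i (Finset.mem_filter.2 ⟨hi, h⟩)
        simp only [h, if_true]; omega
      · simp [h]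
    · set F : ι → ι → ℝ := fun i l => b i * b l * ((if H.Adj i l then 1 else 0) +
        (if H.Adj i l ∧ (if H.Adj x i then q i else k) = (if H.Adj x l then q l else k)
          then 1 else 0) - (if (if H.Adj x i then q i else k) = (if H.Adj x l then q l else k)
          then 0 else 1)) with hF
      have hsplit : ∀ g : ι → ℝ, ∑ i ∈ S, g i = ∑ i ∈ N, g i + ∑ i ∈ A, g i := fun g =>
        (Finset.sum_filter_add_sum_filter_not S _ g).symm
      have hFsymm : ∀ i l, F i l = F l i := by
        intro i l
        simp only [hF, H.adj_comm i l, eq_comm, mul_comm (b i) (b l)]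
      have hNN : ∑ i ∈ N, ∑ l ∈ N, F i l ≤ 0 := by
        refine le_of_eq_of_le (Finset.sum_congr rfl fun i hi => Finset.sum_congr rfl fun l hl => ?_) hq
        have hi' := (Finset.mem_filter.1 hi).2
        have hl' := (Finset.mem_filter.1 hl).2
        simp only [hF, hi', hl', if_true]
      have hNA : ∑ i ∈ N, ∑ l ∈ A, F i l = ∑ i ∈ A, ∑ l ∈ N, F i l := by
        rw [Finset.sum_comm]
        exact Finset.sum_congr rfl fun i _ => Finset.sum_congr rfl fun l _ => hFsymm _ _
      have hA' : ∀ i ∈ A, ∑ l ∈ A, F i l + 2 * ∑ l ∈ N, F i l ≤ 0 := by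
        intro i hi
        obtain ⟨hiS, hi'⟩ := Finset.mem_filter.1 hi
        have h1 : ∑ l ∈ A, F i l = b i * (2 * ∑ l ∈ A, b l * (if H.Adj i l then 1 else 0)) := by
          rw [Finset.mul_sum, Finset.mul_sum]
          refine Finset.sum_congr rfl fun l hl => ?_
          have hl' := (Finset.mem_filter.1 hl).2
          by_cases h : H.Adj i l <;> simp [hF, hi', hl', h]; ring
        have h2 : ∑ l ∈ N, F i l = b i * (∑ l ∈ N, b l * (if H.Adj i l then 1 else 0)
            - ∑ l ∈ N, b l) := by
          rw [← Finset.sum_sub_distrib, Finset.mul_sum]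
          refine Finset.sum_congr rfl fun l hl => ?_
          have hl' := (Finset.mem_filter.1 hl).2
          have hne : k ≠ q l := (hqk l hl).ne'
          by_cases h : H.Adj i l <;> simp [hF, hi', hl', h, hne]
        have h3 := hmax i hiS
        rw [hsplit, hsplit] at h3
        have h4 : ∑ l ∈ N, b l * (if H.Adj x l then (1 : ℝ) else 0) = ∑ l ∈ N, b l :=
          Finset.sum_congr rfl fun l hl => by simp [(Finset.mem_filter.1 hl).2]
        have h5 : ∑ l ∈ A, b l * (if H.Adj x l then (1 : ℝ) else 0) = 0 :=
          Finset.sum_eq_zero fun l hl => by simp [(Finset.mem_filter.1 hl).2]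
        rw [h1, h2]
        rw [h4, h5] at h3
        have := mul_le_mul_of_nonneg_left h3 (hb i)
        linarith
      have hsum : ∑ i ∈ S, ∑ l ∈ S, F i l = ∑ i ∈ N, ∑ l ∈ N, F i l +
          ∑ i ∈ A, (∑ l ∈ A, F i l + 2 * ∑ l ∈ N, F i l) := by
        rw [hsplit]
        simp only [hsplit (F _)]
        rw [Finset.sum_add_distrib, Finset.sum_add_distrib, Finset.sum_add_distrib, hNA,
          ← Finset.mul_sum]
        ring
      rw [hsum]
      have := Finset.sum_nonpos hA'
      linarith

/-- Stability for weighted Turán problems on a fixed vertex set: a `K_{k+1}`-free graph `H` has a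
`k`-partition such that every pair on which `H` differs from the complete multipartite graph weighs
at most the deficit of `H`. -/
theorem exists_partition_of_cliqueFree [Fintype ι] (b : ι → ℝ) (hb : ∀ i, 0 ≤ b i)
    (H : SimpleGraph ι) (hH : H.CliqueFree (k + 1)) :
    ∃ q : ι → Fin k, edgeWeight b H + sqWeight b q ≤ (∑ i, b i) ^ 2 ∧
      ∀ i l, i ≠ l → ¬ (H.Adj i l ↔ q i ≠ q l) →
        b i * b l ≤ (∑ i, b i) ^ 2 - sqWeight b q - edgeWeight b H := by
  classical
  obtain ⟨q', hq'k, hq'⟩ := exists_partition_of_cliqueFreeOn b hb H k univ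
    (hH.cliqueFreeOn)
  set q : ι → Fin k := fun i => ⟨q' i, hq'k i (mem_univ i)⟩ with hqdef
  have hqq : ∀ i l, (q i = q l) ↔ q' i = q' l := fun i l => by simp [hqdef, Fin.ext_iff]
  simp only [← hqq] at hq'
  -- `C` and `E` weigh the non-edges across classes and the edges inside classes.
  set E := ∑ i, ∑ l, b i * b l * (if H.Adj i l ∧ q i = q l then 1 else 0) with hE
  set C := ∑ i, ∑ l, b i * b l * (if ¬ H.Adj i l ∧ q i ≠ q l then 1 else 0) with hC
  have hbb : ∀ i l, 0 ≤ b i * b l := fun i l => mul_nonneg (hb i) (hb l)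
  have hkey : (∑ i, b i) ^ 2 - sqWeight b q - edgeWeight b H = C - E := by
    rw [sqWeight_eq_sum, edgeWeight, hC, hE, sq, Finset.sum_mul_sum]
    simp only [← Finset.sum_sub_distrib]
    refine Finset.sum_congr rfl fun i _ => Finset.sum_congr rfl fun l _ => ?_
    by_cases h1 : H.Adj i l <;> by_cases h2 : q i = q l <;> simp [h1, h2]
  have hCE : 2 * E ≤ C := by
    have : ∑ i, ∑ l, b i * b l * ((if H.Adj i l then (1 : ℝ) else 0) +
        (if H.Adj i l ∧ q i = q l then 1 else 0) - (if q i = q l then 0 else 1)) = 2 * E - C := by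
      rw [hC, hE, Finset.mul_sum, ← Finset.sum_sub_distrib]
      refine Finset.sum_congr rfl fun i _ => ?_
      rw [Finset.mul_sum, ← Finset.sum_sub_distrib]
      refine Finset.sum_congr rfl fun l _ => ?_
      by_cases h1 : H.Adj i l <;> by_cases h2 : q i = q l <;> simp [h1, h2]; ring
    rw [this] at hq'
    linarith
  have hE0 : 0 ≤ E := Finset.sum_nonneg fun i _ => Finset.sum_nonneg fun l _ =>
    mul_nonneg (hbb i l) (by split_ifs <;> norm_num)
  have hpair : ∀ g : ι → ι → ℝ, (∀ i l, 0 ≤ g i l) → ∀ i l, i ≠ l →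
      g i l + g l i ≤ ∑ i, ∑ l, g i l := by
    intro g hg i l hil
    calc g i l + g l i ≤ ∑ l', g i l' + ∑ l', g l l' := add_le_add
          (Finset.single_le_sum (f := g i) (fun _ _ => hg _ _) (mem_univ l))
          (Finset.single_le_sum (f := g l) (fun _ _ => hg _ _) (mem_univ i))
      _ = ∑ i' ∈ {i, l}, ∑ l', g i' l' := by rw [Finset.sum_pair hil]
      _ ≤ _ := Finset.sum_le_sum_of_subset_of_nonneg (subset_univ _)
          fun i _ _ => Finset.sum_nonneg fun _ _ => hg _ _
  refine ⟨q, by linarith, fun i l hil hwrong => ?_⟩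
  rw [hkey]
  by_cases h1 : H.Adj i l
  · have h2 : q i = q l := by by_contra h; exact hwrong ⟨fun _ => h, fun _ => h1⟩
    have := hpair (fun i l => b i * b l * (if H.Adj i l ∧ q i = q l then 1 else 0))
      (fun i l => mul_nonneg (hbb i l) (by split_ifs <;> norm_num)) i l hil
    simp only [h1, h2, h1.symm, and_self, if_true, mul_one] at this
    rw [← hE] at this
    nlinarith [hbb i l, hbb l i, mul_comm (b i) (b l)]
  · have h2 : q i ≠ q l := fun h => hwrong ⟨fun h' => (h1 h').elim, fun h' => (h' h).elim⟩
    have := hpair (fun i l => b i * b l * (if ¬ H.Adj i l ∧ q i ≠ q l then 1 else 0))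
      (fun i l => mul_nonneg (hbb i l) (by split_ifs <;> norm_num)) i l hil
    have h1' : ¬ H.Adj l i := fun h => h1 h.symm
    rw [if_pos ⟨h1, h2⟩, if_pos ⟨h1', h2.symm⟩, ← hC] at this
    nlinarith [mul_comm (b i) (b l)]

end WeightedTuran

/-! ### Near-optimal partitions -/

section NearOptimal

variable {ι : Type*} {k : ℕ}

/-- The weights `b`, supported on `B`, after the parts of size below `α * m` have been given
weight `0`.  The number `m` is the `k`-th largest weight: at least `k` weights are at least `m`
and fewer than `k` are above `m`. -/
structure IsScaled (b : ι → ℝ) (B : Finset ι) (k : ℕ) (m α : ℝ) : Prop where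
  m_pos : 0 < m
  α_pos : 0 < α
  α_le : α ≤ 1
  off : ∀ i ∉ B, b i = 0
  le : ∀ i ∈ B, α * m ≤ b i
  top : ∃ K ⊆ B, K.card = k ∧ ∀ i ∈ K, m ≤ b i
  few : ∃ K : Finset ι, K.card < k ∧ ∀ i ∉ K, b i ≤ m

theorem IsScaled.pos {b : ι → ℝ} {B : Finset ι} {m α : ℝ} (h : IsScaled b B k m α) {i : ι} (hi : i ∈ B) : 0 < b i :=
  (mul_pos h.α_pos h.m_pos).trans_le (h.le i hi)

theorem IsScaled.nonneg {b : ι → ℝ} {B : Finset ι} {m α : ℝ} (h : IsScaled b B k m α) (i : ι) : 0 ≤ b i := by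
  by_cases hi : i ∈ B
  · exact (h.pos hi).le
  · exact (h.off i hi).ge

variable [Fintype ι]

/-- The partition `q` minimizes `sqWeight` up to an error of `ζ`, i.e. its complete multipartite
graph has nearly the maximum weight. -/
def NearOpt (b : ι → ℝ) (ζ : ℝ) (q : ι → Fin k) : Prop :=
  ∀ q' : ι → Fin k, sqWeight b q ≤ sqWeight b q' + ζ

theorem classWeight_nonneg {b : ι → ℝ} (hb : ∀ i, 0 ≤ b i) (q : ι → Fin k) (j : Fin k) :
    0 ≤ classWeight b q j :=
  Finset.sum_nonneg fun i _ => by split_ifs <;> simp [hb]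

theorem classWeight_update [DecidableEq ι] (b : ι → ℝ) (q : ι → Fin k) (i : ι) (x j : Fin k) :
    classWeight b (Function.update q i x) j =
      classWeight b q j - (if q i = j then b i else 0) + if x = j then b i else 0 := by
  unfold classWeight
  rw [← Finset.add_sum_erase _ _ (mem_univ i), ← Finset.add_sum_erase (s := univ) (a := i)
    (f := fun l => if q l = j then b l else 0) (mem_univ i)]
  have : ∀ l ∈ univ.erase i, (if Function.update q i x l = j then b l else 0) =
      if q l = j then b l else 0 := fun l hl => by
    rw [Function.update_of_ne (Finset.ne_of_mem_erase hl)]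
  rw [Finset.sum_congr rfl this, Function.update_self]
  ring

theorem single_le_classWeight {b : ι → ℝ} (hb : ∀ i, 0 ≤ b i) (q : ι → Fin k) (i : ι) :
    b i ≤ classWeight b q (q i) := by
  have := Finset.single_le_sum (f := fun l => if q l = q i then b l else 0)
    (fun l _ => by split_ifs <;> simp [hb]) (mem_univ i)
  simpa [classWeight] using this

theorem pair_le_classWeight [DecidableEq ι] {b : ι → ℝ} (hb : ∀ i, 0 ≤ b i) (q : ι → Fin k)
    {i l : ι} (hil : i ≠ l) (h : q i = q l) : b i + b l ≤ classWeight b q (q i) := by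
  have := Finset.sum_le_sum_of_subset_of_nonneg (f := fun l => if q l = q i then b l else 0)
    (subset_univ {i, l}) (fun l _ _ => by split_ifs <;> simp [hb])
  rw [Finset.sum_pair hil] at this
  simpa [classWeight, h] using this

/-- `sqWeight` changes only through the two classes on which two partitions differ. -/
theorem sqWeight_sub_of_two (b : ι → ℝ) (q q' : ι → Fin k) {j j' : Fin k} (hj : j ≠ j')
    (h : ∀ x, x ≠ j → x ≠ j' → classWeight b q x = classWeight b q' x) :
    sqWeight b q - sqWeight b q' = classWeight b q j ^ 2 + classWeight b q j' ^ 2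
      - classWeight b q' j ^ 2 - classWeight b q' j' ^ 2 := by
  have key : ∀ q'' : ι → Fin k, sqWeight b q'' = classWeight b q'' j ^ 2 +
      classWeight b q'' j' ^ 2 + ∑ x ∈ univ \ {j, j'}, classWeight b q'' x ^ 2 := by
    intro q''
    rw [sqWeight, ← Finset.sum_sdiff (subset_univ {j, j'}), Finset.sum_pair hj, add_comm]
  rw [key, key, Finset.sum_congr rfl fun x hx => ?_]
  · ring
  · simp only [mem_sdiff, mem_univ, true_and, mem_insert, mem_singleton, not_or] at hx
    rw [h x hx.1 hx.2]

theorem sqWeight_update_sub [DecidableEq ι] (b : ι → ℝ) (q : ι → Fin k) (i : ι) {j : Fin k}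
    (hj : j ≠ q i) : sqWeight b q - sqWeight b (Function.update q i j) =
      2 * b i * (classWeight b q (q i) - b i - classWeight b q j) := by
  rw [sqWeight_sub_of_two b q (Function.update q i j) hj.symm, classWeight_update,
    classWeight_update]
  · simp only [if_true, hj.symm, hj, if_false]; ring
  · intro x hx hx'
    rw [classWeight_update, if_neg hx.symm, if_neg hx'.symm]; ring

theorem sum_eq_sum_classWeight (b : ι → ℝ) (q : ι → Fin k) :
    ∑ j, classWeight b q j = ∑ i, b i := by
  unfold classWeight
  rw [Finset.sum_comm]
  simp

theorem sqWeight_congr {b : ι → ℝ} {B : Finset ι} (hoff : ∀ i ∉ B, b i = 0) {q q' : ι → Fin k}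
    (h : ∀ i ∈ B, ∀ l ∈ B, (q i = q l ↔ q' i = q' l)) : sqWeight b q = sqWeight b q' := by
  rw [sqWeight_eq_sum, sqWeight_eq_sum]
  refine Finset.sum_congr rfl fun i _ => Finset.sum_congr rfl fun l _ => ?_
  by_cases hi : i ∈ B
  · by_cases hl : l ∈ B
    · simp only [h i hi l hl]
    · simp [hoff l hl]
  · simp [hoff i hi]

theorem NearOpt.congr {b : ι → ℝ} {B : Finset ι} (hoff : ∀ i ∉ B, b i = 0) {q q' : ι → Fin k}
    (h : ∀ i ∈ B, ∀ l ∈ B, (q i = q l ↔ q' i = q' l)) {ζ : ℝ} (hq : NearOpt b ζ q) :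
    NearOpt b ζ q' := fun q'' => by
  rw [← sqWeight_congr hoff h]; exact hq q''

namespace IsScaled

variable {b : ι → ℝ} {B : Finset ι} {m α : ℝ}

/-- Fewer than `k` weights exceed `m`, so some class contains none of them. -/
theorem exists_light_class [DecidableEq ι] (h : IsScaled b B k m α) (q : ι → Fin k) :
    ∃ j, classWeight b q j ≤ Fintype.card ι * m ∧ ∀ i, q i = j → b i ≤ m := by
  obtain ⟨K, hK, hKm⟩ := h.few
  have : ∃ j : Fin k, j ∉ K.image q := by
    by_contra! hcon
    have h1 : (univ : Finset (Fin k)).card ≤ (K.image q).card :=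
      Finset.card_le_card fun j _ => hcon j
    have h2 : (K.image q).card ≤ K.card := Finset.card_image_le
    simp at h1
    omega
  obtain ⟨j, hj⟩ := this
  have hle : ∀ i, q i = j → b i ≤ m := fun i hi => hKm i fun hiK =>
    hj (Finset.mem_image.2 ⟨i, hiK, hi⟩)
  refine ⟨j, ?_, hle⟩
  calc classWeight b q j ≤ ∑ _i : ι, m := Finset.sum_le_sum fun i _ => by
        split_ifs with hi
        · exact hle i hi
        · exact h.m_pos.le
    _ = _ := by simp

variable {θ : ℝ} {q : ι → Fin k}

/-- Moving one vertex to another class does not gain much. -/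
theorem classWeight_sub_le [DecidableEq ι] (h : IsScaled b B k m α) (hθ : 0 ≤ θ)
    (hq : NearOpt b (2 * α * θ * m ^ 2) q) {i : ι} (hi : i ∈ B) {j : Fin k} (hj : j ≠ q i) :
    classWeight b q (q i) - b i ≤ classWeight b q j + θ * m := by
  have h1 := hq (Function.update q i j)
  have h2 := sqWeight_update_sub b q i hj
  by_contra! hcon
  have h3 : θ * m < classWeight b q (q i) - b i - classWeight b q j := by linarith
  have h4 := mul_lt_mul_of_pos_left h3 (h.pos hi)
  have h5 := mul_le_mul_of_nonneg_right (h.le i hi) (mul_nonneg hθ h.m_pos.le)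
  nlinarith

/-- If a class is lighter than `m`, two of the `k` weights above `m` share another class. -/
theorem le_classWeight [DecidableEq ι] (h : IsScaled b B k m α) (hθ : 0 ≤ θ)
    (hq : NearOpt b (2 * α * θ * m ^ 2) q) (j : Fin k) : (1 - θ) * m ≤ classWeight b q j := by
  have hm := h.m_pos
  obtain ⟨K, hKB, hK, hKm⟩ := h.top
  by_cases hj : ∃ i ∈ K, q i = j
  · obtain ⟨i, hi, rfl⟩ := hj
    have := single_le_classWeight h.nonneg q i
    have := hKm i hi
    nlinarith [mul_nonneg hθ hm.le]
  · push Not at hj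
    have hmaps : ∀ i ∈ K, q i ∈ (univ : Finset (Fin k)).erase j := fun i hi =>
      Finset.mem_erase.2 ⟨hj i hi, mem_univ _⟩
    have hcard : ((univ : Finset (Fin k)).erase j).card < K.card := by
      rw [Finset.card_erase_of_mem (mem_univ _), hK, Finset.card_univ, Fintype.card_fin]
      have := j.pos
      omega
    obtain ⟨i, hi, l, hl, hil, hq'⟩ := Finset.exists_ne_map_eq_of_card_lt_of_maps_to hcard hmaps
    have h1 := h.classWeight_sub_le hθ hq (hKB hi) (hj i hi).symm
    have h2 := pair_le_classWeight h.nonneg q hil hq'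
    have h3 := hKm l hl
    linarith

theorem exists_mem_class [DecidableEq ι] (h : IsScaled b B k m α) (hθ : 0 ≤ θ) (hθ1 : θ < 1)
    (hq : NearOpt b (2 * α * θ * m ^ 2) q) (j : Fin k) : ∃ i ∈ B, q i = j := by
  by_contra! hcon
  have h1 := h.le_classWeight hθ hq j
  have h2 : classWeight b q j = 0 := Finset.sum_eq_zero fun i _ => by
    by_cases hi : i ∈ B
    · rw [if_neg (hcon i hi)]
    · simp [h.off i hi]
  nlinarith [h.m_pos]

/-- A very heavy vertex is alone in its class. -/
theorem ne_of_heavy [DecidableEq ι] (h : IsScaled b B k m α) (hθ : 0 ≤ θ) (hθ1 : θ < 1)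
    (hq : NearOpt b (2 * α * θ * m ^ 2) q) {i l : ι}
    (hi : (2 * Fintype.card ι + 2) * m ≤ b i) (hl : l ∈ B) (hil : i ≠ l) : q i ≠ q l := by
  intro heq
  have hm := h.m_pos
  have hr : (0 : ℝ) ≤ Fintype.card ι := by positivity
  obtain ⟨j, hj, hjm⟩ := h.exists_light_class q
  have hne : j ≠ q l := by
    intro hjl
    have := hjm i (by rw [heq, hjl])
    nlinarith [mul_nonneg hr hm.le]
  have h1 := h.classWeight_sub_le hθ hq hl hne
  have h2 := pair_le_classWeight h.nonneg q hil.symm heq.symm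
  nlinarith [mul_nonneg hr hm.le]

end IsScaled

end NearOptimal

/-! ### Near-optimal partitions with movable vertices -/

section Swaps

variable {ι : Type*} {k : ℕ}

/-- The weight of the vertices that may be put into the class `j`, if `S i` is the set of the
classes allowed for `i`. -/
def touchWeight (b : ι → ℝ) (B : Finset ι) (S : ι → Finset (Fin k)) (j : Fin k) : ℝ :=
  ∑ i ∈ B with j ∈ S i, b i

/-- The weight of the vertices that must be put into the class `j`, if `S i` is the set of the
classes allowed for `i`. -/
def innerWeight (b : ι → ℝ) (B : Finset ι) (S : ι → Finset (Fin k)) (j : Fin k) : ℝ :=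
  ∑ i ∈ B with S i = {j}, b i

variable {b : ι → ℝ} {B : Finset ι} {m α θ : ℝ} {q : ι → Fin k} {S : ι → Finset (Fin k)}

theorem innerWeight_add_le_touchWeight (hb : IsScaled b B k m α) {l : ι} (hl : l ∈ B) {j x : Fin k} (hj : j ∈ S l)
    (hx : x ∈ S l) (hxj : x ≠ j) : innerWeight b B S j + b l ≤ touchWeight b B S j := by
  classical
  have hnot : l ∉ B.filter fun i => S i = {j} := by
    simp only [mem_filter, not_and]
    intro _ h
    rw [h, mem_singleton] at hx
    exact hxj hx
  rw [innerWeight, touchWeight, add_comm, ← Finset.sum_insert hnot]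
  refine Finset.sum_le_sum_of_subset_of_nonneg ?_ fun i _ _ => hb.nonneg i
  intro i hi
  rcases Finset.mem_insert.1 hi with rfl | hi
  · exact mem_filter.2 ⟨hl, hj⟩
  · obtain ⟨h1, h2⟩ := mem_filter.1 hi
    exact mem_filter.2 ⟨h1, by simp [h2]⟩

variable [Fintype ι]

theorem classWeight_eq_touchWeight (hoff : ∀ i ∉ B, b i = 0) {q : ι → Fin k} {j : Fin k}
    (h1 : ∀ i ∈ B, q i ∈ S i) (h2 : ∀ i ∈ B, j ∈ S i → q i = j) :
    classWeight b q j = touchWeight b B S j := by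
  rw [classWeight, touchWeight, Finset.sum_filter,
    ← Finset.sum_subset (subset_univ B) fun i _ hi => by simp [hoff i hi]]
  refine Finset.sum_congr rfl fun i hi => ?_
  have : q i = j ↔ j ∈ S i := ⟨fun h => h ▸ h1 i hi, h2 i hi⟩
  simp only [this]

theorem classWeight_eq_innerWeight (hoff : ∀ i ∉ B, b i = 0) {q : ι → Fin k} {j : Fin k}
    (h1 : ∀ i ∈ B, q i ∈ S i) (h2 : ∀ i ∈ B, q i = j → S i = {j}) :
    classWeight b q j = innerWeight b B S j := by
  rw [classWeight, innerWeight, Finset.sum_filter,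
    ← Finset.sum_subset (subset_univ B) fun i _ hi => by simp [hoff i hi]]
  refine Finset.sum_congr rfl fun i hi => ?_
  have : q i = j ↔ S i = {j} := ⟨h2 i hi, fun h => by simpa [h] using h1 i hi⟩
  simp only [this]

variable [DecidableEq ι]

/-- `q` is near-optimal and remains so after any one or two vertices `i` are moved to other classes
from the set `S i`. -/
structure IsSwapOpt (b : ι → ℝ) (ζ : ℝ) (B : Finset ι) (q : ι → Fin k)
    (S : ι → Finset (Fin k)) : Prop where
  mem : ∀ i, q i ∈ S i
  self : NearOpt b ζ q
  single : ∀ i ∈ B, ∀ j ∈ S i, NearOpt b ζ (Function.update q i j)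
  pair : ∀ i ∈ B, ∀ l ∈ B, i ≠ l → ∀ j ∈ S i, ∀ j' ∈ S l,
    NearOpt b ζ (Function.update (Function.update q i j) l j')

namespace IsSwapOpt

variable (hS : IsSwapOpt b (2 * α * θ * m ^ 2) B q S) (hb : IsScaled b B k m α) (hθ : 0 ≤ θ)
  (hθα : 2 * θ < α)

include hS hb hθ hθα

/-- Two vertices with several allowed classes cannot both be put into the same class. -/
theorem eq_of_partial {i i' : ι} (hi : i ∈ B) (hi' : i' ∈ B) {j j₁ j₂ : Fin k} (h1 : j ∈ S i)
    (h2 : j ∈ S i') (h3 : j₁ ∈ S i) (h31 : j₁ ≠ j) (h4 : j₂ ∈ S i') (h41 : j₂ ≠ j) : i = i' := by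
  by_contra hne
  have hq1 := hS.pair i hi i' hi' hne j h1 j h2
  have hq2 := hS.pair i hi i' hi' hne j₁ h3 j₂ h4
  have e1 := hb.classWeight_sub_le hθ hq1 hi (j := j₁) (by
    rw [Function.update_of_ne hne, Function.update_self]; exact h31)
  have e2 := hb.classWeight_sub_le hθ hq2 hi (j := j) (by
    rw [Function.update_of_ne hne, Function.update_self]; exact h31.symm)
  rw [Function.update_of_ne hne, Function.update_self] at e1 e2
  simp only [classWeight_update, Function.update_of_ne (Ne.symm hne), if_true, h31, h31.symm, h41,
    if_false] at e1 e2
  have p1 := hb.pos hi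
  have p2 := hb.pos hi'
  have p3 := hb.le i' hi'
  have hm := hb.m_pos
  have p4 : 2 * θ * m < α * m := mul_lt_mul_of_pos_right hθα hm
  split_ifs at e1 e2 <;> linarith

/-- Some near-optimal partition puts every vertex into `j` that may be put there, and no vertex into
`j'` that may be put elsewhere. -/
theorem exists_nearOpt_of_ne {j j' : Fin k} (hjj : j ≠ j') :
    ∃ q' : ι → Fin k, NearOpt b (2 * α * θ * m ^ 2) q' ∧ (∀ i ∈ B, q' i ∈ S i) ∧
      (∀ i ∈ B, j ∈ S i → q' i = j) ∧ ∀ i ∈ B, q' i = j' → S i = {j'} := by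
  have hF1 := fun {i i'} => hS.eq_of_partial hb hθ hθα (i := i) (i' := i')
  have hmem := hS.mem
  have hsing : ∀ i x, x ∈ S i → (∀ y ∈ S i, y = x) → S i = {x} := fun i x hx hy =>
    Finset.eq_singleton_iff_unique_mem.2 ⟨hx, hy⟩
  by_cases hA : ∃ l ∈ B, j ∈ S l ∧ ∃ x ∈ S l, x ≠ j
  · obtain ⟨l, hl, hjl, x, hx, hxj⟩ := hA
    by_cases hB : ∃ l ∈ B, j' ∈ S l ∧ ∃ x ∈ S l, x ≠ j'
    · obtain ⟨l', hl', hjl', x', hx', hxj'⟩ := hB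
      by_cases hll : l = l'
      · subst hll
        refine ⟨Function.update q l j, hS.single l hl j hjl, ?_, ?_, ?_⟩
        all_goals
          intro i hi
          by_cases hil : i = l
          · subst hil; simp [hjl, hjj]
          rw [Function.update_of_ne hil]
        · exact hmem i
        · intro hji
          by_contra hne
          exact hil (hF1 hi hl hji hjl (hmem i) hne hx hxj)
        · intro hq
          refine hsing i j' (hq ▸ hmem i) fun y hy => ?_
          by_contra hne
          exact hil (hF1 hi hl (hq ▸ hmem i) hjl' hy hne hx' hxj')
      · refine ⟨_, hS.pair l hl l' hl' hll j hjl x' hx', ?_, ?_, ?_⟩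
        all_goals
          intro i hi
          by_cases hil' : i = l'
          · subst hil'
            rw [Function.update_self]
            first
            | exact hx'
            | exact fun h => (hll (hF1 hl hi hjl h hx hxj hjl' hjj.symm)).elim
            | exact fun h => (hxj' h).elim
          by_cases hil : i = l
          · subst hil
            rw [Function.update_of_ne hll, Function.update_self]
            simp [hjl, hjj]
          rw [Function.update_of_ne hil', Function.update_of_ne hil]
        · exact hmem i
        · intro hji
          by_contra hne
          exact hil (hF1 hi hl hji hjl (hmem i) hne hx hxj)
        · intro hq
          refine hsing i j' (hq ▸ hmem i) fun y hy => ?_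
          by_contra hne
          exact hil' (hF1 hi hl' (hq ▸ hmem i) hjl' hy hne hx' hxj')
    · push Not at hB
      refine ⟨Function.update q l j, hS.single l hl j hjl, ?_, ?_, ?_⟩
      all_goals
        intro i hi
        by_cases hil : i = l
        · subst hil; simp [hjl, hjj]
        rw [Function.update_of_ne hil]
      · exact hmem i
      · intro hji
        by_contra hne
        exact hil (hF1 hi hl hji hjl (hmem i) hne hx hxj)
      · intro hq
        exact hsing i j' (hq ▸ hmem i) (hB i hi (hq ▸ hmem i))
  · push Not at hA
    by_cases hB : ∃ l ∈ B, j' ∈ S l ∧ ∃ x ∈ S l, x ≠ j'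
    · obtain ⟨l', hl', hjl', x', hx', hxj'⟩ := hB
      refine ⟨Function.update q l' x', hS.single l' hl' x' hx', ?_, ?_, ?_⟩
      all_goals
        intro i hi
        by_cases hil : i = l'
        · subst hil
          rw [Function.update_self]
          first
          | exact hx'
          | exact fun h => (hjj (hA i hi h j' hjl').symm).elim
          | exact fun h => (hxj' h).elim
        rw [Function.update_of_ne hil]
      · exact hmem i
      · exact fun hji => hA i hi hji _ (hmem i)
      · intro hq
        refine hsing i j' (hq ▸ hmem i) fun y hy => ?_
        by_contra hne
        exact hil (hF1 hi hl' (hq ▸ hmem i) hjl' hy hne hx' hxj')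
    · push Not at hB
      exact ⟨q, hS.self, fun i _ => hmem i, fun i hi hji => hA i hi hji _ (hmem i),
        fun i hi hq => hsing i j' (hq ▸ hmem i) (hB i hi (hq ▸ hmem i))⟩

theorem le_innerWeight (j : Fin k) : (1 - θ) * m ≤ innerWeight b B S j := by
  have hF1 := fun {i i'} => hS.eq_of_partial hb hθ hθα (i := i) (i' := i')
  have hmem := hS.mem
  have hsing : ∀ i x, x ∈ S i → (∀ y ∈ S i, y = x) → S i = {x} := fun i x hx hy =>
    Finset.eq_singleton_iff_unique_mem.2 ⟨hx, hy⟩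
  by_cases hB : ∃ l ∈ B, j ∈ S l ∧ ∃ x ∈ S l, x ≠ j
  · obtain ⟨l, hl, hjl, x, hx, hxj⟩ := hB
    rw [← classWeight_eq_innerWeight hb.off (q := Function.update q l x)]
    · exact hb.le_classWeight hθ (hS.single l hl x hx) j
    all_goals
      intro i hi
      by_cases hil : i = l
      · subst hil; simp [hx, hxj]
      rw [Function.update_of_ne hil]
    · exact hmem i
    · intro hq
      refine hsing i j (hq ▸ hmem i) fun y hy => ?_
      by_contra hne
      exact hil (hF1 hi hl (hq ▸ hmem i) hjl hy hne hx hxj)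
  · push Not at hB
    rw [← classWeight_eq_innerWeight hb.off (q := q) (fun i _ => hmem i)
      fun i hi hq => hsing i j (hq ▸ hmem i) (hB i hi (hq ▸ hmem i))]
    exact hb.le_classWeight hθ hS.self j

theorem touchWeight_sub_le {i : ι} (hi : i ∈ B) {j j' : Fin k} (hj : j ∈ S i) (hjj : j ≠ j') :
    touchWeight b B S j - b i ≤ innerWeight b B S j' + θ * m := by
  obtain ⟨q', hq', h1, h2, h3⟩ := hS.exists_nearOpt_of_ne hb hθ hθα hjj
  have hqi := h2 i hi hj
  have := hb.classWeight_sub_le hθ hq' hi (j := j') (by rw [hqi]; exact hjj.symm)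
  rwa [hqi, classWeight_eq_touchWeight hb.off h1 h2, classWeight_eq_innerWeight hb.off h1 h3]
    at this

/-- If `l` has several allowed classes, then merging the rest of one of them with another one and
leaving `l` alone in its class does not gain much; so `l` is not heavier than what must be put into
any class. -/
theorem le_innerWeight_of_partial (hθ1 : θ ≤ 1 / 2) {l : ι} (hl : l ∈ B) {j x : Fin k}
    (hj : j ∈ S l) (hx : x ∈ S l) (hxj : x ≠ j) (j' : Fin k) :
    b l ≤ innerWeight b B S j' + 3 * θ * m := by
  have hm := hb.m_pos
  have hα := hb.α_le
  -- The merged class is compared with `x` first, which is itself not much heavier than `j'`.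
  have key : b l ≤ innerWeight b B S x + 2 * θ * m := by
    obtain ⟨q', hq', h1, h2, h3⟩ := hS.exists_nearOpt_of_ne hb hθ hθα hxj.symm
    have hql := h2 l hl hj
    set q'' : ι → Fin k := fun i => if q' i = j ∧ i ≠ l then x else q' i with hq''
    have e1 : classWeight b q'' j = b l := by
      rw [classWeight, Finset.sum_eq_single l]
      · simp [hq'', hql]
      · intro i _ hil
        by_cases h : q' i = j <;> simp [hq'', h, hil, hxj]
      · simp
    have e2 : classWeight b q'' j + classWeight b q'' x =
        classWeight b q' j + classWeight b q' x := by
      simp only [classWeight, ← Finset.sum_add_distrib]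
      refine Finset.sum_congr rfl fun i _ => ?_
      by_cases h : q' i = j
      · by_cases hil : i = l
        · subst hil; simp [hq'', hql, hxj.symm]
        · simp [hq'', h, hil, hxj, hxj.symm]
      · simp [hq'', h]
    have e3 := sqWeight_sub_of_two b q' q'' hxj.symm fun y hy hy' => by
      refine Finset.sum_congr rfl fun i _ => ?_
      by_cases h : q' i = j
      · by_cases hil : i = l
        · subst hil; simp [hq'', hql]
        · simp [hq'', h, hil, hy.symm, hy'.symm]
      · simp [hq'', h]
    have e4 := hq' q''
    rw [classWeight_eq_touchWeight hb.off h1 h2, classWeight_eq_innerWeight hb.off h1 h3] at e2 e3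
    have e5 := innerWeight_add_le_touchWeight hb hl hj hx hxj
    have e6 := hS.le_innerWeight hb hθ hθα j
    have e7 : m / 2 ≤ touchWeight b B S j - b l := by nlinarith
    have e8 : classWeight b q'' x = touchWeight b B S j - b l + innerWeight b B S x := by linarith
    rw [e1, e8] at e3
    set D := touchWeight b B S j - b l with hD
    have e9 : touchWeight b B S j = D + b l := by rw [hD]; ring
    rw [e9] at e3
    by_contra! hcon
    have e10 : 2 * θ * m < b l - innerWeight b B S x := by linarith
    have e11 : D * (2 * θ * m) ≤ D * (b l - innerWeight b B S x) :=
      mul_le_mul_of_nonneg_left e10.le (by linarith)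
    have e12 : 0 < D * (b l - innerWeight b B S x - 2 * θ * m) :=
      mul_pos (by linarith) (by linarith)
    have e13 : m / 2 * (2 * θ * m) ≤ D * (2 * θ * m) :=
      mul_le_mul_of_nonneg_right e7 (by positivity)
    have e14 : α * (θ * m ^ 2) ≤ 1 * (θ * m ^ 2) :=
      mul_le_mul_of_nonneg_right hα (by positivity)
    nlinarith
  by_cases hxj' : x = j'
  · subst hxj'
    nlinarith [mul_nonneg hθ hm.le]
  · have h1 := hS.touchWeight_sub_le hb hθ hθα hl hx hxj'
    have h2 := innerWeight_add_le_touchWeight hb hl hx hj hxj.symm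
    linarith

/-- If `l` has several allowed classes, among them `j`, then any other vertex that can be put into
`j` is about as heavy as `l` at least. -/
theorem le_of_partial {l i : ι} (hl : l ∈ B) (hi : i ∈ B) {j x : Fin k}
    (hj : j ∈ S l) (hx : x ∈ S l) (hxj : x ≠ j) (hji : j ∈ S i) : b l ≤ b i + 2 * θ * m := by
  have h1 := hS.touchWeight_sub_le hb hθ hθα hi hji hxj.symm
  have h2 := hS.touchWeight_sub_le hb hθ hθα hl hx hxj
  have h3 := innerWeight_add_le_touchWeight hb hl hj hx hxj
  have h4 := innerWeight_add_le_touchWeight hb hl hx hj hxj.symm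
  linarith

end IsSwapOpt

end Swaps

/-! ### Random transversals -/

section Transversals

variable {ι W : Type*} {k : ℕ}

theorem exists_perm_of_kernel_eq (s : Finset ι) (q q₁ : ι → Fin k)
    (h : ∀ i ∈ s, ∀ l ∈ s, (q i = q l ↔ q₁ i = q₁ l)) :
    ∃ σ : Equiv.Perm (Fin k), ∀ i ∈ s, σ (q₁ i) = q i := by
  classical
  have hex : ∀ y : Fin k, ∃ z : Fin k, ∀ i ∈ s, q₁ i = y → q i = z := fun y => by
    by_cases hy : ∃ i ∈ s, q₁ i = y
    · obtain ⟨i, hi, hiy⟩ := hy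
      exact ⟨q i, fun l hl hly => (h l hl i hi).2 (hly.trans hiy.symm)⟩
    · exact ⟨y, fun i hi hiy => (hy ⟨i, hi, hiy⟩).elim⟩
  choose g hg using hex
  have hinj : Set.InjOn g (s.image q₁ : Finset (Fin k)) := by
    intro y hy z hz hyz
    obtain ⟨i, hi, rfl⟩ := Finset.mem_image.1 (Finset.mem_coe.1 hy)
    obtain ⟨l, hl, rfl⟩ := Finset.mem_image.1 (Finset.mem_coe.1 hz)
    rw [← hg _ i hi rfl, ← hg _ l hl rfl] at hyz
    exact (h i hi l hl).1 hyz
  obtain ⟨e, he⟩ := Finset.exists_equiv_extend_of_card_eq (t := (univ : Finset (Fin k))) (by simp)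
    (s := s.image q₁) (f := g) (subset_univ _) hinj
  refine ⟨e.trans (Equiv.subtypeUnivEquiv fun x => mem_univ x), fun i hi => ?_⟩
  rw [hg _ i hi rfl, ← he _ (mem_image_of_mem _ hi)]
  rfl

/-- On the parts in `B`, the graph induced by the transversal `u` is the complete multipartite graph
with classes `q`. -/
def Represents (G : SimpleGraph W) (B : Finset ι) (u : ι → W) (q : ι → Fin k) : Prop :=
  ∀ i ∈ B, ∀ l ∈ B, G.Adj (u i) (u l) ↔ q i ≠ q l

theorem Represents.kernel {G : SimpleGraph W} {B : Finset ι} {u : ι → W} {q q' : ι → Fin k}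
    (h : Represents G B u q) (h' : Represents G B u q') :
    ∀ i ∈ B, ∀ l ∈ B, (q i = q l ↔ q' i = q' l) := fun i hi l hl =>
  not_iff_not.1 ((h i hi l hl).symm.trans (h' i hi l hl))

theorem cliqueFree_comap {G : SimpleGraph W} {n : ℕ} (hG : G.CliqueFree n) (u : ι → W) :
    (G.comap u).CliqueFree n := by
  by_contra h
  obtain ⟨e⟩ := (SimpleGraph.not_cliqueFree_iff_top_isContained n).1 h
  let f : (⊤ : SimpleGraph (Fin n)) →g G := ⟨fun a => u (e a), fun {a b} hab => e.toHom.map_adj hab⟩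
  have hf : Function.Injective f := fun a b hab => by
    by_contra hne
    exact (G.ne_of_adj (f.map_adj (show (⊤ : SimpleGraph (Fin n)).Adj a b from hne))) hab
  exact (SimpleGraph.not_cliqueFree_iff_top_isContained n).2 ⟨⟨f, hf⟩⟩ hG

/-- How far the weight of the graph induced by the transversal `u` is below the optimum, if `q₀` is an
optimal partition (twice the difference, as `edgeWeight` runs over ordered pairs). -/
noncomputable def defect [Fintype ι] (b : ι → ℝ) (q₀ : ι → Fin k) (G : SimpleGraph W) (u : ι → W) :
    ℝ :=
  (∑ i, b i) ^ 2 - sqWeight b q₀ - edgeWeight b (G.comap u)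

theorem defect_nonneg [Fintype ι] {G : SimpleGraph W} {b : ι → ℝ} {q₀ : ι → Fin k}
    (hb : ∀ i, 0 ≤ b i) (hG : G.CliqueFree (k + 1))
    (hq₀ : ∀ q : ι → Fin k, sqWeight b q₀ ≤ sqWeight b q) (u : ι → W) :
    0 ≤ defect b q₀ G u := by
  obtain ⟨q, hq, -⟩ := exists_partition_of_cliqueFree b hb _ (cliqueFree_comap hG u)
  have := hq₀ q
  rw [defect]
  linarith

variable [DecidableEq ι]

/-- After one vertex of a transversal is replaced, the classes can be labelled as before. -/
theorem Represents.exists_update {G : SimpleGraph W} {B : Finset ι} {u : ι → W} {q q₁ : ι → Fin k}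
    {i : ι} {x : W} (h : Represents G B u q) (h₁ : Represents G B (Function.update u i x) q₁) :
    ∃ j, Represents G B (Function.update u i x) (Function.update q i j) := by
  obtain ⟨σ, hσ⟩ := exists_perm_of_kernel_eq (B.erase i) q q₁ fun a ha l hl => by
    have e1 := h a (mem_of_mem_erase ha) l (mem_of_mem_erase hl)
    have e2 := h₁ a (mem_of_mem_erase ha) l (mem_of_mem_erase hl)
    rw [Function.update_of_ne (ne_of_mem_erase ha), Function.update_of_ne (ne_of_mem_erase hl)]
      at e2
    exact not_iff_not.1 (e1.symm.trans e2)
  have hval : ∀ a ∈ B, Function.update q i (σ (q₁ i)) a = σ (q₁ a) := fun a ha => by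
    by_cases hai : a = i
    · subst hai; simp
    · rw [Function.update_of_ne hai, hσ a (mem_erase.2 ⟨hai, ha⟩)]
  refine ⟨σ (q₁ i), fun a ha l hl => ?_⟩
  rw [hval a ha, hval l hl, h₁ a ha l hl, Ne, Ne, σ.injective.eq_iff]

/-- If the effects of two single replacements on a transversal are known, and the double replacement
yields a complete multipartite graph with `k` classes, then the two effects add up. -/
theorem Represents.update_update {G : SimpleGraph W} {B : Finset ι} {u : ι → W} {q q' : ι → Fin k}
    {i l : ι} (hl : l ∈ B) (hil : i ≠ l) {x y : W} {jx jy : Fin k}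
    (hq : ∀ j, ∃ a ∈ B, q a = j)
    (hx : Represents G B (Function.update u i x) (Function.update q i jx))
    (hxs : ∀ j, ∃ a ∈ B, Function.update q i jx a = j)
    (hy : Represents G B (Function.update u l y) (Function.update q l jy))
    (hys : ∀ j, ∃ a ∈ B, Function.update q l jy a = j)
    (hxy : Represents G B (Function.update (Function.update u i x) l y) q')
    (hs : ∀ q'' : ι → Fin k, Represents G B (Function.update (Function.update u i x) l y) q'' →
      ∀ j, ∃ a ∈ B, q'' a = j) :
    Represents G B (Function.update (Function.update u i x) l y)
      (Function.update (Function.update q i jx) l jy) := by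
  obtain ⟨j', h1⟩ := hx.exists_update hxy
  have hcomm : Function.update (Function.update u i x) l y =
      Function.update (Function.update u l y) i x := Function.update_comm hil _ _ _
  obtain ⟨j'', h2⟩ := hy.exists_update (hcomm ▸ hxy)
  rw [← hcomm] at h2
  suffices j' = jy by rwa [this] at h1
  have hker := h1.kernel h2
  have hs1 := hs _ h1
  have hs2 := hs _ h2
  by_contra hne
  -- No vertex besides `i` and `l` lies in the classes `j'` and `jy`.
  have hno : ∀ z ∈ B, z ≠ i → z ≠ l → q z ≠ j' ∧ q z ≠ jy := by
    intro z hz hzi hzl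
    have := hker l hl z hz
    rw [Function.update_self, Function.update_of_ne hzl, Function.update_of_ne hzi,
      Function.update_of_ne hil.symm, Function.update_self, Function.update_of_ne hzi,
      Function.update_of_ne hzl] at this
    constructor
    · intro h
      exact hne (h ▸ (this.1 h.symm).symm)
    · intro h
      exact hne ((this.2 h.symm).trans h)
  have hcase : ∀ (q'' : ι → Fin k) (j : Fin k), (∃ a ∈ B, q'' a = j) →
      (∀ z ∈ B, z ≠ i → z ≠ l → q'' z ≠ j) → q'' i = j ∨ q'' l = j := by
    rintro q'' j ⟨a, ha, haj⟩ h
    by_cases hai : a = i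
    · exact Or.inl (hai ▸ haj)
    by_cases hal : a = l
    · exact Or.inr (hal ▸ haj)
    exact (h a ha hai hal haj).elim
  have c1 := hcase _ jy (hs1 jy) fun z hz hzi hzl => by
    rw [Function.update_of_ne hzl, Function.update_of_ne hzi]; exact (hno z hz hzi hzl).2
  have c3 := hcase _ j' (hxs j') fun z hz hzi hzl => by
    rw [Function.update_of_ne hzi]; exact (hno z hz hzi hzl).1
  have c4 := hcase _ j' (hys j') fun z hz hzi hzl => by
    rw [Function.update_of_ne hzl]; exact (hno z hz hzi hzl).1
  have c5 := hcase _ jy (hq jy) fun z hz hzi hzl => (hno z hz hzi hzl).2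
  simp only [Function.update_self, Function.update_of_ne hil, Function.update_of_ne hil.symm]
    at c1 c3 c4 c5
  grind

section Defect

variable [Fintype ι] {G : SimpleGraph W} {b : ι → ℝ} {B : Finset ι} {m α θ : ℝ} {q₀ : ι → Fin k}
  (hb : IsScaled b B k m α) (hG : G.CliqueFree (k + 1))
  (hq₀ : ∀ q : ι → Fin k, sqWeight b q₀ ≤ sqWeight b q)

include hb hG hq₀

/-- A transversal with a small defect induces a complete multipartite graph on `B`, with a
near-optimal partition. -/
theorem exists_represents_of_defect_le (hθα : 2 * θ < α) {u : ι → W}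
    (hu : defect b q₀ G u ≤ 2 * α * θ * m ^ 2) :
    ∃ q : ι → Fin k, Represents G B u q ∧ NearOpt b (2 * α * θ * m ^ 2) q := by
  obtain ⟨q, hq, hw⟩ := exists_partition_of_cliqueFree b hb.nonneg _ (cliqueFree_comap hG u)
  rw [defect] at hu
  have h0 := hq₀ q
  refine ⟨q, fun i hi l hl => ?_, fun q' => ?_⟩
  · by_cases hil : i = l
    · subst hil; simp
    by_contra hne
    have h1 := hw i l hil hne
    have h2 := mul_le_mul (hb.le i hi) (hb.le l hl) (mul_pos hb.α_pos hb.m_pos).le (hb.nonneg i)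
    have h3 : α * (2 * θ) * m ^ 2 < α * α * m ^ 2 :=
      mul_lt_mul_of_pos_right (mul_lt_mul_of_pos_left hθα hb.α_pos) (pow_pos hb.m_pos 2)
    nlinarith
  · have := hq₀ q'
    linarith

/-- A missing edge at a very heavy part costs its whole weight: no other vertex shares the class
of the heavy part in a near-optimal partition. -/
theorem mul_le_defect_of_heavy {u : ι → W} {i l : ι} (hil : i ≠ l)
    (hi : (2 * Fintype.card ι + 2) * m ≤ b i) (hadj : ¬ G.Adj (u i) (u l)) :
    b i * b l ≤ defect b q₀ G u := by
  obtain ⟨q, hq, hw⟩ := exists_partition_of_cliqueFree b hb.nonneg _ (cliqueFree_comap hG u)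
  have h0 := hq₀ q
  rw [defect]
  by_cases h : q i = q l
  · have hm := hb.m_pos
    have hr : (0 : ℝ) ≤ Fintype.card ι * m := by positivity
    obtain ⟨j, hj, hjm⟩ := hb.exists_light_class q
    have hne : j ≠ q l := by
      intro hjl
      have := hjm i (by rw [h, hjl])
      nlinarith
    have h1 := sqWeight_update_sub b q l hne
    have h2 := pair_le_classWeight hb.nonneg q hil.symm h.symm
    have h3 := hq₀ (Function.update q l j)
    have h4 : b i ≤ 2 * (classWeight b q (q l) - b l - classWeight b q j) := by nlinarith
    have h5 := mul_le_mul_of_nonneg_left h4 (hb.nonneg l)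
    nlinarith
  · have := hw i l hil fun hiff => hadj (hiff.2 h)
    linarith

end Defect

section Averaging

/-- Replacing the `i`-th entry of a random transversal by a random element of `T i` gives a random
transversal. -/
theorem sum_sum_update (T : ι → Finset W) [Fintype ι] (F : (ι → W) → ℝ) (i : ι) :
    ∑ u ∈ Fintype.piFinset T, ∑ x ∈ T i, F (Function.update u i x) =
      (T i).card * ∑ u ∈ Fintype.piFinset T, F u := by
  have h1 : ((T i).card : ℝ) * ∑ u ∈ Fintype.piFinset T, F u =
      ∑ z ∈ Fintype.piFinset T ×ˢ T i, F z.1 := by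
    rw [Finset.sum_product, Finset.mul_sum]
    simp
  rw [h1, ← Finset.sum_product (s := Fintype.piFinset T) (t := T i)
    (f := fun z => F (Function.update z.1 i z.2))]
  have hmaps : ∀ z ∈ Fintype.piFinset T ×ˢ T i,
      (Function.update z.1 i z.2, z.1 i) ∈ Fintype.piFinset T ×ˢ T i := by
    rintro ⟨u, x⟩ hz
    rw [mem_product, Fintype.mem_piFinset] at hz ⊢
    refine ⟨fun l => ?_, hz.1 i⟩
    by_cases hl : l = i
    · subst hl; simpa using hz.2
    · simpa [hl] using hz.1 l
  exact Finset.sum_nbij' (fun z => (Function.update z.1 i z.2, z.1 i))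
    (fun z => (Function.update z.1 i z.2, z.1 i)) hmaps hmaps (by simp) (by simp) (by simp)

theorem sum_sum_sum_update [Fintype ι] (T : ι → Finset W) (F : (ι → W) → ℝ) (i l : ι) :
    ∑ u ∈ Fintype.piFinset T, ∑ x ∈ T i, ∑ y ∈ T l,
      F (Function.update (Function.update u i x) l y) =
      (T i).card * (T l).card * ∑ u ∈ Fintype.piFinset T, F u := by
  rw [sum_sum_update T (fun u => ∑ y ∈ T l, F (Function.update u l y)) i, sum_sum_update]
  ring

theorem card_mul_card_mul_sum_pair [Fintype ι] (T : ι → Finset W) (g : W → W → ℝ) {i l : ι}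
    (hil : i ≠ l) :
    (T i).card * (T l).card * ∑ u ∈ Fintype.piFinset T, g (u i) (u l) =
      (Fintype.piFinset T).card * ∑ x ∈ T i, ∑ y ∈ T l, g x y := by
  rw [← sum_sum_sum_update T (fun u => g (u i) (u l))]
  simp [hil]

/-- Some transversal `u` is at most as bad as `1 + r ^ 2` times the average, and so are its double
replacements on average. -/
theorem exists_transversal [Fintype ι] (T : ι → Finset W) (hT : ∀ i, (T i).Nonempty)
    (F : (ι → W) → ℝ) (hF : ∀ u, 0 ≤ F u) {η : ℝ}
    (h : ∑ u ∈ Fintype.piFinset T, F u ≤ (Fintype.piFinset T).card * η) :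
    ∃ u ∈ Fintype.piFinset T, F u ≤ (1 + Fintype.card ι ^ 2) * η ∧
      ∀ i l, ∑ x ∈ T i, ∑ y ∈ T l, F (Function.update (Function.update u i x) l y) ≤
        (T i).card * (T l).card * ((1 + Fintype.card ι ^ 2) * η) := by
  have hc : ∀ i, (0 : ℝ) < (T i).card := fun i => by exact_mod_cast (hT i).card_pos
  set A : (ι → W) → ι → ι → ℝ := fun u i l =>
    ∑ x ∈ T i, ∑ y ∈ T l, F (Function.update (Function.update u i x) l y) with hA
  have hA0 : ∀ u i l, 0 ≤ A u i l := fun u i l =>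
    Finset.sum_nonneg fun _ _ => Finset.sum_nonneg fun _ _ => hF _
  set Φ : (ι → W) → ℝ := fun u => F u + ∑ i, ∑ l, A u i l / ((T i).card * (T l).card) with hΦ
  have hne : (Fintype.piFinset T).Nonempty := Fintype.piFinset_nonempty.2 hT
  have hsum : ∑ u ∈ Fintype.piFinset T, Φ u =
      (1 + Fintype.card ι ^ 2) * ∑ u ∈ Fintype.piFinset T, F u := by
    rw [hΦ, Finset.sum_add_distrib, Finset.sum_comm]
    have : ∀ i l, ∑ u ∈ Fintype.piFinset T, A u i l / ((T i).card * (T l).card) =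
        ∑ u ∈ Fintype.piFinset T, F u := fun i l => by
      rw [← Finset.sum_div, hA, sum_sum_sum_update]
      have := (hc i).ne'
      have := (hc l).ne'
      field_simp
    simp_rw [Finset.sum_comm (s := Fintype.piFinset T), this]
    simp
    ring
  obtain ⟨u, hu, hle⟩ := Finset.exists_le_of_sum_le hne (f := Φ)
    (g := fun _ => (1 + (Fintype.card ι : ℝ) ^ 2) * η) (by
      rw [hsum, Finset.sum_const, nsmul_eq_mul]
      nlinarith [mul_le_mul_of_nonneg_left h (show (0 : ℝ) ≤ 1 + (Fintype.card ι : ℝ) ^ 2 by positivity)])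
  have hterm : ∀ i l, 0 ≤ A u i l / ((T i).card * (T l).card) := fun i l =>
    div_nonneg (hA0 u i l) (by positivity)
  have hnn : 0 ≤ ∑ i, ∑ l, A u i l / ((T i).card * (T l).card) :=
    Finset.sum_nonneg fun i _ => Finset.sum_nonneg fun l _ => hterm i l
  refine ⟨u, hu, by simp only [hΦ] at hle; linarith, fun i l => ?_⟩
  have h1 : A u i l / ((T i).card * (T l).card) ≤ ∑ i, ∑ l, A u i l / ((T i).card * (T l).card) :=
    (Finset.single_le_sum (f := fun l => A u i l / ((T i).card * (T l).card))
      (fun l _ => hterm i l) (mem_univ l)).trans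
    (Finset.single_le_sum (f := fun i => ∑ l, A u i l / ((T i).card * (T l).card))
      (fun i _ => Finset.sum_nonneg fun l _ => hterm i l) (mem_univ i))
  have h2 : A u i l / ((T i).card * (T l).card) ≤ (1 + (Fintype.card ι : ℝ) ^ 2) * η := by
    have := hF u
    simp only [hΦ] at hle
    linarith
  rw [div_le_iff₀ (mul_pos (hc i) (hc l))] at h2
  simp only [hA] at h2
  linarith

end Averaging

end Transversals

/-! ### From transversals to a partition of the vertices -/

section VertexLabelling

variable {ι W : Type*} {k : ℕ} [DecidableEq ι] [Fintype ι]

theorem nearOpt_of_represents {G : SimpleGraph W} {b : ι → ℝ} {B : Finset ι} {m α θ : ℝ}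
    {q₀ q : ι → Fin k} (hb : IsScaled b B k m α) (hG : G.CliqueFree (k + 1))
    (hq₀ : ∀ q : ι → Fin k, sqWeight b q₀ ≤ sqWeight b q) (hθα : 2 * θ < α) {u : ι → W}
    (hu : defect b q₀ G u ≤ 2 * α * θ * m ^ 2) (hq : Represents G B u q) :
    NearOpt b (2 * α * θ * m ^ 2) q := by
  obtain ⟨q', hq', hn⟩ := exists_represents_of_defect_le hb hG hq₀ hθα hu
  exact hn.congr hb.off (hq'.kernel hq)

theorem card_filter_mul_le {β : Type*} (s : Finset β) (g : β → ℝ) (hg : ∀ x, 0 ≤ g x) (ζ : ℝ) :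
    ((s.filter fun x => ζ < g x).card : ℝ) * ζ ≤ ∑ x ∈ s, g x := by
  rw [← nsmul_eq_mul, ← Finset.sum_const]
  exact (Finset.sum_le_sum fun x hx => (mem_filter.1 hx).2.le).trans
    (Finset.sum_le_sum_of_subset_of_nonneg (filter_subset _ _) fun x _ _ => hg x)

/-- The partition of the vertices.  If transversals have small defect on average, then the vertices
can be labelled with the classes of a near-optimal partition `q` of the parts, up to a small set
`X` of exceptional vertices and a small set `Z` of exceptional pairs: other pairs in different parts
are adjacent exactly if their labels differ, and `q` remains near-optimal if the
parts of two such vertices are moved to the classes of these vertices. -/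
theorem exists_vertex_labelling [Fintype W] [DecidableEq W] {G : SimpleGraph W} {c : W → ι}
    {b : ι → ℝ} {B : Finset ι} {m α θ : ℝ} {q₀ : ι → Fin k} {T : ι → Finset W}
    (hb : IsScaled b B k m α) (hbc : ∀ i ∈ B, b i = (cls c i).card)
    (hG : G.CliqueFree (k + 1)) (hq₀ : ∀ q : ι → Fin k, sqWeight b q₀ ≤ sqWeight b q)
    (hT : ∀ i, (T i).Nonempty) (hTc : ∀ i ∈ B, T i = cls c i) (hθ : 0 < θ) (hθα : 2 * θ < α)
    {η N R x₀ : ℝ} (hη : 0 ≤ η) (hx₀ : 0 ≤ x₀)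
    (havg : ∑ u ∈ Fintype.piFinset T, defect b q₀ G u ≤ (Fintype.piFinset T).card * η)
    (hN : N = (2 * Fintype.card ι + 2) * m) (hηR : η ≤ R)
    (h1 : (1 + Fintype.card ι ^ 2) * η ≤ 2 * α * θ * m ^ 2)
    (h2 : N * ((1 + Fintype.card ι ^ 2) * η) ≤ x₀ * (2 * α * θ * m ^ 2))
    (h3 : N ^ 2 * ((1 + Fintype.card ι ^ 2) * η) ≤ R * (2 * α * θ * m ^ 2)) :
    ∃ (q : ι → Fin k) (p : W → Fin k) (X : Finset W) (Z : Finset (W × W)),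
      NearOpt b (2 * α * θ * m ^ 2) q ∧ (X.card : ℝ) ≤ Fintype.card ι * x₀ ∧
      (Z.card : ℝ) ≤ Fintype.card ι ^ 2 * R ∧
      (∀ v, c v ∈ B → v ∉ X → NearOpt b (2 * α * θ * m ^ 2) (Function.update q (c v) (p v))) ∧
      ∀ x y, c x ∈ B → c y ∈ B → c x ≠ c y → x ∉ X → y ∉ X → (x, y) ∉ Z →
        (G.Adj x y ↔ p x ≠ p y) ∧ NearOpt b (2 * α * θ * m ^ 2)
          (Function.update (Function.update q (c x) (p x)) (c y) (p y)) := by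
  classical
  have hm := hb.m_pos
  have hα := hb.α_pos
  set ζ := 2 * α * θ * m ^ 2 with hζ
  have hζ0 : 0 < ζ := by positivity
  have hθ1 : θ < 1 := by have := hb.α_le; linarith
  set D : (ι → W) → ℝ := defect b q₀ G with hD
  have hD0 : ∀ u, 0 ≤ D u := defect_nonneg hb.nonneg hG hq₀
  have hr0 : (0 : ℝ) ≤ (1 + (Fintype.card ι : ℝ) ^ 2) * η := by positivity
  have hN0 : 0 ≤ N := by rw [hN]; positivity
  obtain ⟨u, hu, hDu, hpair⟩ := exists_transversal T hT D hD0 havg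
  obtain ⟨q, hqrep, hqopt⟩ := exists_represents_of_defect_le hb hG hq₀ hθα (hDu.trans h1)
  have hsurj : ∀ {q' : ι → Fin k}, NearOpt b ζ q' → ∀ j, ∃ a ∈ B, q' a = j := fun h =>
    hb.exists_mem_class hθ.le hθ1 h
  have hcardT : ∀ i ∈ B, ((T i).card : ℝ) = b i := fun i hi => by rw [hTc i hi, hbc i hi]
  have hmemT : ∀ v, c v ∈ B → v ∈ T (c v) := fun v hv => by
    rw [hTc _ hv]; simp [cls]
  set heavy : ι → Prop := fun i => N ≤ b i with hheavy
  have hlab : ∀ v, ∃ j, c v ∈ B → D (Function.update u (c v) v) ≤ ζ →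
      Represents G B (Function.update u (c v) v) (Function.update q (c v) j) := fun v => by
    by_cases hv : c v ∈ B ∧ D (Function.update u (c v) v) ≤ ζ
    · obtain ⟨q₁, hq₁, -⟩ := exists_represents_of_defect_le hb hG hq₀ hθα hv.2
      obtain ⟨j, hj⟩ := hqrep.exists_update hq₁
      exact ⟨j, fun _ _ => hj⟩
    · exact ⟨q (c v), fun h h' => (hv ⟨h, h'⟩).elim⟩
  choose p₀ hp₀ using hlab
  set p : W → Fin k := fun v => if heavy (c v) then q (c v) else p₀ v with hp
  set X : Finset W := univ.filter fun v =>
    (c v ∈ B ∧ ¬ heavy (c v)) ∧ ζ < D (Function.update u (c v) v) with hX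
  -- At a heavy part there are too many vertices for Markov's inequality to be of use, so pairs
  -- at heavy parts are judged by adjacency itself.
  set Z : Finset (W × W) := univ.filter fun z => (c z.1 ∈ B ∧ c z.2 ∈ B ∧ c z.1 ≠ c z.2) ∧
    if heavy (c z.1) ∨ heavy (c z.2) then ¬ G.Adj z.1 z.2 else
      ζ < D (Function.update (Function.update u (c z.1) z.1) (c z.2) z.2) with hZ
  have hpheavy : ∀ v, heavy (c v) → p v = q (c v) := fun v hv => by simp [hp, hv]
  have hgood : ∀ v, c v ∈ B → v ∉ X → ¬ heavy (c v) → D (Function.update u (c v) v) ≤ ζ :=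
    fun v hv hvX hh => by
      by_contra hcon
      exact hvX (mem_filter.2 ⟨mem_univ _, ⟨hv, hh⟩, not_le.1 hcon⟩)
  have hprep : ∀ v, c v ∈ B → v ∉ X → ¬ heavy (c v) →
      Represents G B (Function.update u (c v) v) (Function.update q (c v) (p v)) :=
    fun v hv hvX hh => by
      have := hp₀ v hv (hgood v hv hvX hh)
      simpa [hp, hh] using this
  have hsingle : ∀ v, c v ∈ B → v ∉ X → NearOpt b ζ (Function.update q (c v) (p v)) := by
    intro v hv hvX
    by_cases hh : heavy (c v)
    · rw [hpheavy v hh, Function.update_eq_self]; exact hqopt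
    · exact nearOpt_of_represents hb hG hq₀ hθα (hgood v hv hvX hh) (hprep v hv hvX hh)
  refine ⟨q, p, X, Z, hqopt, ?_, ?_, hsingle, ?_⟩
  · -- Double replacements in the same part are single replacements.
    have hfib := Finset.card_eq_sum_card_fiberwise (f := c) (s := X) (t := univ)
      (fun _ _ => mem_coe.2 (mem_univ _))
    rw [hfib, Nat.cast_sum]
    refine (Finset.sum_le_card_nsmul _ _ x₀ fun i _ => ?_).trans (by simp)
    by_cases hi : i ∈ B ∧ ¬ heavy i
    · have e1 := hpair i i
      simp only [Function.update_idem, Finset.sum_const, nsmul_eq_mul, mul_assoc] at e1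
      have hTi : (0 : ℝ) < (T i).card := by exact_mod_cast (hT i).card_pos
      have e2 := le_of_mul_le_mul_left e1 hTi
      have e3 := card_filter_mul_le (T i) (fun v => D (Function.update u i v)) (fun _ => hD0 _) ζ
      have e4 : (X.filter fun v => c v = i).card ≤
          ((T i).filter fun v => ζ < D (Function.update u i v)).card := by
        refine Finset.card_le_card fun v hv => ?_
        obtain ⟨hvX, rfl⟩ := mem_filter.1 hv
        exact mem_filter.2 ⟨hmemT v hi.1, (mem_filter.1 hvX).2.2⟩
      have e5 : ((T i).card : ℝ) * ((1 + (Fintype.card ι : ℝ) ^ 2) * η) ≤ x₀ * ζ := by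
        refine le_trans (mul_le_mul_of_nonneg_right ?_ hr0) h2
        rw [hcardT i hi.1]
        exact (not_le.1 hi.2).le
      have e6 : (((X.filter fun v => c v = i).card : ℕ) : ℝ) ≤
          ((T i).filter fun v => ζ < D (Function.update u i v)).card := by exact_mod_cast e4
      have e7 := mul_le_mul_of_nonneg_right e6 hζ0.le
      exact le_of_mul_le_mul_right (by linarith) hζ0
    · rw [Finset.filter_eq_empty_iff.2]
      · simpa using hx₀
      · rintro v hv rfl
        exact hi (mem_filter.1 hv).2.1
  · have hfib := Finset.card_eq_sum_card_fiberwise (f := fun z : W × W => (c z.1, c z.2)) (s := Z)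
      (t := univ) (fun _ _ => mem_coe.2 (mem_univ _))
    rw [hfib, Nat.cast_sum]
    refine (Finset.sum_le_card_nsmul _ _ R fun z _ => ?_).trans (le_of_eq (by
      simp [sq]))
    obtain ⟨i, l⟩ := z
    by_cases hil : i ∈ B ∧ l ∈ B ∧ i ≠ l
    · obtain ⟨hi, hl, hne⟩ := hil
      have hbi := hb.pos hi
      have hbl := hb.pos hl
      by_cases hh : heavy i ∨ heavy l
      · refine le_trans ?_ hηR
        set g : W → W → ℝ := fun x y => if G.Adj x y then 0 else b i * b l with hg
        have e1 := card_mul_card_mul_sum_pair T g hne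
        have e2 : ∑ v ∈ Fintype.piFinset T, g (v i) (v l) ≤ (Fintype.piFinset T).card * η := by
          refine le_trans (Finset.sum_le_sum fun v _ => ?_) havg
          simp only [hg]
          split_ifs with hadj
          · exact hD0 v
          · rcases hh with hh | hh
            · exact mul_le_defect_of_heavy hb hG hq₀ hne (hN ▸ hh) hadj
            · rw [mul_comm]
              exact mul_le_defect_of_heavy hb hG hq₀ hne.symm (hN ▸ hh) fun h => hadj h.symm
        have e3 : ((Z.filter fun z => (c z.1, c z.2) = (i, l)).card : ℝ) * (b i * b l) ≤
            ∑ x ∈ T i, ∑ y ∈ T l, g x y := by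
          rw [← Finset.sum_product (s := T i) (t := T l) (f := fun z => g z.1 z.2), ← nsmul_eq_mul,
            ← Finset.sum_const]
          have hsub : (Z.filter fun z => (c z.1, c z.2) = (i, l)) ⊆ T i ×ˢ T l := by
            rintro ⟨x, y⟩ hz
            obtain ⟨hz, hc⟩ := mem_filter.1 hz
            obtain ⟨rfl, rfl⟩ := Prod.mk.inj hc
            exact mem_product.2 ⟨hmemT x hi, hmemT y hl⟩
          refine (Finset.sum_le_sum fun z hz => ?_).trans
            (Finset.sum_le_sum_of_subset_of_nonneg hsub fun z _ _ => ?_)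
          · obtain ⟨hz, hc⟩ := mem_filter.1 hz
            have h' := (mem_filter.1 hz).2.2
            simp only [Prod.mk.injEq] at hc
            rw [hc.1, hc.2, if_pos hh] at h'
            simp [hg, h']
          · simp only [hg]; split_ifs <;> positivity
        have hP : (0 : ℝ) < (Fintype.piFinset T).card := by
          exact_mod_cast (Fintype.piFinset_nonempty.2 hT).card_pos
        rw [hcardT i hi, hcardT l hl] at e1
        have hbb : 0 < b i * b l := mul_pos hbi hbl
        have e4 := mul_le_mul_of_nonneg_left e3 hP.le
        have e5 := mul_le_mul_of_nonneg_left e2 hbb.le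
        refine le_of_mul_le_mul_right (a := (Fintype.piFinset T).card * (b i * b l)) ?_
          (mul_pos hP hbb)
        linarith
      · have e1 := hpair i l
        rw [← Finset.sum_product (s := T i) (t := T l)
          (f := fun z => D (Function.update (Function.update u i z.1) l z.2))] at e1
        have e2 := card_filter_mul_le (T i ×ˢ T l)
          (fun z => D (Function.update (Function.update u i z.1) l z.2)) (fun _ => hD0 _) ζ
        have e3 : (Z.filter fun z => (c z.1, c z.2) = (i, l)).card ≤ ((T i ×ˢ T l).filter fun z =>
            ζ < D (Function.update (Function.update u i z.1) l z.2)).card := by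
          refine Finset.card_le_card ?_
          rintro ⟨x, y⟩ hz
          obtain ⟨hzZ, hc⟩ := mem_filter.1 hz
          obtain ⟨rfl, rfl⟩ := Prod.mk.inj hc
          have h' := (mem_filter.1 hzZ).2.2
          rw [if_neg hh] at h'
          exact mem_filter.2 ⟨mem_product.2 ⟨hmemT x hi, hmemT y hl⟩, h'⟩
        have e3' : ((Z.filter fun z => (c z.1, c z.2) = (i, l)).card : ℝ) ≤
            ((T i ×ˢ T l).filter fun z =>
            ζ < D (Function.update (Function.update u i z.1) l z.2)).card := by exact_mod_cast e3
        have e4 := mul_le_mul_of_nonneg_right e3' hζ0.le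
        simp only [hheavy, not_or, not_le] at hh
        have e5 : ((T i).card : ℝ) * (T l).card * ((1 + (Fintype.card ι : ℝ) ^ 2) * η) ≤ R * ζ := by
          refine le_trans (mul_le_mul_of_nonneg_right ?_ hr0) h3
          rw [hcardT i hi, hcardT l hl, sq]
          exact mul_le_mul hh.1.le hh.2.le hbl.le hN0
        exact le_of_mul_le_mul_right (by linarith) hζ0
    · rw [Finset.filter_eq_empty_iff.2]
      · simpa using hη.trans hηR
      · rintro ⟨x, y⟩ hz hc
        obtain ⟨rfl, rfl⟩ := Prod.mk.inj hc
        exact hil (mem_filter.1 hz).2.1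
  · intro x y hx hy hne hxX hyX hxyZ
    have hZ' : (if heavy (c x) ∨ heavy (c y) then G.Adj x y else
        D (Function.update (Function.update u (c x) x) (c y) y) ≤ ζ) := by
      by_contra hcon
      refine hxyZ (mem_filter.2 ⟨mem_univ _, ⟨hx, hy, hne⟩, ?_⟩)
      dsimp only
      split_ifs at hcon ⊢ with h
      · exact hcon
      · exact not_le.1 hcon
    by_cases hh : heavy (c x) ∨ heavy (c y)
    · rw [if_pos hh] at hZ'
      by_cases hhx : heavy (c x)
      · have hopt := hsingle y hy hyX
        have := hb.ne_of_heavy hθ.le hθ1 hopt (hN ▸ hhx) hy hne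
        rw [Function.update_of_ne hne, Function.update_self] at this
        rw [hpheavy x hhx, Function.update_eq_self]
        exact ⟨iff_of_true hZ' this, hopt⟩
      · have hhy := hh.resolve_left hhx
        have hopt := hsingle x hx hxX
        have := hb.ne_of_heavy hθ.le hθ1 hopt (hN ▸ hhy) hx hne.symm
        rw [Function.update_of_ne hne.symm, Function.update_self] at this
        rw [hpheavy y hhy, Function.update_comm hne, Function.update_eq_self]
        exact ⟨iff_of_true hZ' this.symm, hopt⟩
    · rw [if_neg hh] at hZ'
      obtain ⟨hhx, hhy⟩ := not_or.1 hh
      obtain ⟨q', hq', -⟩ := exists_represents_of_defect_le hb hG hq₀ hθα hZ'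
      have hrep := Represents.update_update hy hne (hsurj hqopt) (hprep x hx hxX hhx)
        (hsurj (hsingle x hx hxX)) (hprep y hy hyX hhy) (hsurj (hsingle y hy hyX)) hq'
        fun q'' h'' => hsurj (nearOpt_of_represents hb hG hq₀ hθα hZ' h'')
      refine ⟨?_, nearOpt_of_represents hb hG hq₀ hθα hZ' hrep⟩
      have := hrep (c x) hx (c y) hy
      rwa [Function.update_of_ne hne, Function.update_self, Function.update_self,
        Function.update_of_ne hne, Function.update_self, Function.update_self] at this

end VertexLabelling

/-! ### Deleting vertices to obtain a stable partition -/

section Cleaning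

section Families

variable {W ι κ : Type*} [DecidableEq W] [Fintype ι]

theorem integralPart_subset (𝒜 : ι → Finset W) (ℬ : κ → Finset W) (j : κ) :
    integralPart 𝒜 ℬ j ⊆ ℬ j := by
  intro v hv
  simp only [integralPart, mem_biUnion, mem_filter, mem_univ, true_and] at hv
  obtain ⟨i, hi, hvi⟩ := hv
  exact hi.2 hvi

theorem subset_integralPart {𝒜 : ι → Finset W} {ℬ : κ → Finset W} {i : ι} {j : κ}
    (h : IsIntegralIn 𝒜 ℬ i j) : 𝒜 i ⊆ integralPart 𝒜 ℬ j := by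
  intro v hv
  simp only [integralPart, mem_biUnion, mem_filter, mem_univ, true_and]
  exact ⟨i, h, hv⟩

end Families

section RemovedClasses

variable {W ι κ : Type*} [Fintype W] [DecidableEq W] [DecidableEq ι] [DecidableEq κ]
  {c : W → ι} {p : W → κ} {X : Finset W} {i : ι} {j : κ}

theorem mem_clsOff {v : W} : v ∈ clsOff c X i ↔ c v = i ∧ v ∉ X := by
  simp [clsOff, cls]

theorem mem_clsOff_inter {v : W} :
    v ∈ clsOff c X i ∩ clsOff p X j ↔ c v = i ∧ p v = j ∧ v ∉ X := by
  rw [mem_inter, mem_clsOff, mem_clsOff]; tauto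

theorem isIntegralIn_iff : IsIntegralIn (clsOff c X) (clsOff p X) i j ↔
    (clsOff c X i ∩ clsOff p X j).Nonempty ∧
      ∀ j', (clsOff c X i ∩ clsOff p X j').Nonempty → j' = j := by
  constructor
  · rintro ⟨⟨v, hv⟩, hsub⟩
    refine ⟨⟨v, mem_inter.2 ⟨hv, hsub hv⟩⟩, ?_⟩
    rintro j' ⟨w, hw⟩
    obtain ⟨hw1, hw2⟩ := mem_inter.1 hw
    rw [← (mem_clsOff.1 hw2).1, (mem_clsOff.1 (hsub hw1)).1]
  · rintro ⟨⟨v, hv⟩, h⟩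
    refine ⟨⟨v, (mem_inter.1 hv).1⟩, fun w hw => ?_⟩
    have hwX := (mem_clsOff.1 hw).2
    exact mem_clsOff.2 ⟨h _ ⟨w, mem_inter.2 ⟨hw, mem_clsOff.2 ⟨rfl, hwX⟩⟩⟩, hwX⟩

theorem isPartialIn_iff : IsPartialIn (clsOff c X) (clsOff p X) i j ↔
    (clsOff c X i ∩ clsOff p X j).Nonempty ∧
      ∃ j', (clsOff c X i ∩ clsOff p X j').Nonempty ∧ j' ≠ j := by
  refine and_congr_right fun h => ?_
  constructor
  · intro hsub
    obtain ⟨w, hw, hwj⟩ := Finset.not_subset.1 hsub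
    have hwX := (mem_clsOff.1 hw).2
    refine ⟨p w, ⟨w, mem_inter.2 ⟨hw, mem_clsOff.2 ⟨rfl, hwX⟩⟩⟩, fun h' => hwj ?_⟩
    exact mem_clsOff.2 ⟨h', hwX⟩
  · rintro ⟨j', ⟨w, hw⟩, hne⟩ hsub
    obtain ⟨hw1, hw2⟩ := mem_inter.1 hw
    exact hne ((mem_clsOff.1 hw2).1.symm.trans (mem_clsOff.1 (hsub hw1)).1)

theorem isIntegralIn_or_isPartialIn (h : (clsOff c X i ∩ clsOff p X j).Nonempty) :
    IsIntegralIn (clsOff c X) (clsOff p X) i j ∨ IsPartialIn (clsOff c X) (clsOff p X) i j := by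
  by_cases hsub : clsOff c X i ⊆ clsOff p X j
  · exact Or.inl ⟨h.mono inter_subset_left, hsub⟩
  · exact Or.inr ⟨h, hsub⟩

theorem IsIntegralIn.not_isPartialIn {j' : κ} (h : IsIntegralIn (clsOff c X) (clsOff p X) i j) :
    ¬ IsPartialIn (clsOff c X) (clsOff p X) i j' := fun h' => by
  obtain ⟨h1, j'', h2, hne⟩ := isPartialIn_iff.1 h'
  have := (isIntegralIn_iff.1 h).2
  exact hne ((this _ h2).trans (this _ h1).symm)

theorem mem_integralPart [Fintype ι] {v : W} : v ∈ integralPart (clsOff c X) (clsOff p X) j ↔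
    v ∉ X ∧ IsIntegralIn (clsOff c X) (clsOff p X) (c v) j := by
  simp only [integralPart, mem_biUnion, mem_filter, mem_univ, true_and, mem_clsOff]
  constructor
  · rintro ⟨i, hi, rfl, hX⟩
    exact ⟨hX, hi⟩
  · rintro ⟨hX, hi⟩
    exact ⟨c v, hi, rfl, hX⟩

end RemovedClasses

section Cleaning

variable {W ι : Type*} [Fintype W] [DecidableEq W] [Fintype ι] [DecidableEq ι] {k : ℕ}

/-- A set of classes that is stable up to an error of `e` can be made stable by deleting
a bounded number of sets of size at most `2 * e`.  In every class, vertices of the integral part are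
deleted so that all partial classes get integral parts of the minimum size `y`, and that condition
`card_sdiff_le` holds for the others; every partial class of `c` loses `2 * e` vertices in the class
of `p` that contains most of it, so that it still meets the same classes as before. -/
theorem exists_isStable_of_almost (c : W → ι) (p : W → Fin k) (X : Finset W) (e : ℕ) (hk : 0 < k)
    (hone : ∀ j i i', IsPartialIn (clsOff c X) (clsOff p X) i j →
      IsPartialIn (clsOff c X) (clsOff p X) i' j → i = i')
    (hsdiff : ∀ i j j', (clsOff c X i ∩ clsOff p X j).Nonempty → j' ≠ j →
      (clsOff p X j \ clsOff c X i).card ≤ (integralPart (clsOff c X) (clsOff p X) j').card + e)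
    (hpart : ∀ i j j', IsPartialIn (clsOff c X) (clsOff p X) i j →
      (clsOff c X i).card ≤ (integralPart (clsOff c X) (clsOff p X) j').card + e)
    (hpi : ∀ l i j, IsPartialIn (clsOff c X) (clsOff p X) l j →
      IsIntegralIn (clsOff c X) (clsOff p X) i j → (clsOff c X l).card ≤ (clsOff c X i).card + e)
    (hbig : ∀ i, (clsOff c X i).Nonempty → 2 * k * e < (clsOff c X i).card) :
    ∃ X' : Finset W, X ⊆ X' ∧ X'.card ≤ X.card + 2 * e * (k + Fintype.card ι) ∧
      IsStable (clsOff c X') (clsOff p X') ∧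
      ∃ j₀, ∀ j, (integralPart (clsOff c X) (clsOff p X) j₀).card ≤
        (integralPart (clsOff c X') (clsOff p X') j).card := by
  set A := clsOff c X with hA
  set P := clsOff p X with hP
  set I := integralPart A P with hI
  have hke : 2 * e ≤ 2 * k * e := by nlinarith
  have : Nonempty (Fin k) := ⟨⟨0, hk⟩⟩
  obtain ⟨j₀, -, hj₀⟩ := Finset.exists_min_image univ (fun j => (I j).card) univ_nonempty
  set y := (I j₀).card with hy
  replace hj₀ : ∀ j, y ≤ (I j).card := fun j => hj₀ j (mem_univ j)
  -- The parts of the integral parts that are deleted.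
  have hR : ∀ j, ∃ R ⊆ I j, R.card ≤ 2 * e ∧ y ≤ (I j \ R).card ∧
      (IsPartialClass A P j → (I j \ R).card = y ∧ R.card ≤ e) ∧
      (¬ IsPartialClass A P j → ∀ i, IsIntegralIn A P i j → ((P j \ R) \ A i).card ≤ y) := by
    intro j
    have hcut : ∃ R ⊆ I j, R.card = (I j).card - y :=
      Finset.exists_subset_card_eq (Nat.sub_le _ _)
    obtain ⟨R, hRI, hRc⟩ := hcut
    have hRy : (I j \ R).card = y := by
      have := hj₀ j
      rw [Finset.card_sdiff_of_subset hRI]; omega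
    by_cases hpc : IsPartialClass A P j
    · obtain ⟨l, hl⟩ := hpc
      have hle : (I j).card ≤ y + e := by
        by_cases hjj : j₀ = j
        · rw [hy, hjj]; omega
        refine (Finset.card_le_card ?_).trans (hsdiff l j j₀ hl.1 hjj)
        intro v hv
        refine mem_sdiff.2 ⟨integralPart_subset _ _ _ hv, fun hvl => ?_⟩
        have h1 := (mem_integralPart.1 hv).2
        rw [(mem_clsOff.1 hvl).1] at h1
        exact h1.not_isPartialIn hl
      exact ⟨R, hRI, by omega, hRy.ge, fun _ => ⟨hRy, by omega⟩, fun h => (h ⟨l, hl⟩).elim⟩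
    · have hPI : P j = I j := by
        refine Finset.Subset.antisymm (fun v hv => ?_) (integralPart_subset _ _ _)
        have hvX := (mem_clsOff.1 hv).2
        refine mem_integralPart.2 ⟨hvX, ?_⟩
        refine (isIntegralIn_or_isPartialIn ⟨v, mem_inter.2 ⟨mem_clsOff.2 ⟨rfl, hvX⟩, hv⟩⟩).resolve_right
          fun h => hpc ⟨_, h⟩
      by_cases hsmall : (I j).card ≤ y + 2 * e
      · refine ⟨R, hRI, by omega, hRy.ge, fun h => (hpc h).elim, fun _ i _ => ?_⟩
        rw [hPI, ← hRy]
        exact Finset.card_le_card sdiff_subset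
      · have hjj : j₀ ≠ j := by rintro rfl; omega
        have hIne : (I j).Nonempty := Finset.card_pos.1 (by omega)
        obtain ⟨v, hv⟩ := hIne
        have hv1 := (mem_integralPart.1 hv).2
        by_cases hex : ∃ w ∈ P j, c w ≠ c v
        · obtain ⟨w, hw, hwv⟩ := hex
          have hw1 := (mem_integralPart.1 (hPI ▸ hw)).2
          have hcut : ∀ i, IsIntegralIn A P i j → ∃ R ⊆ A i, R.card = e := fun i hi =>
            Finset.exists_subset_card_eq (by have := hbig i hi.1; omega)
          obtain ⟨R₁, hR₁, hR₁c⟩ := hcut _ hv1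
          obtain ⟨R₂, hR₂, hR₂c⟩ := hcut _ hw1
          have hsubI : R₁ ∪ R₂ ⊆ I j := Finset.union_subset
            (hR₁.trans (subset_integralPart hv1)) (hR₂.trans (subset_integralPart hw1))
          have hcard : (R₁ ∪ R₂).card ≤ 2 * e := (Finset.card_union_le _ _).trans (by omega)
          refine ⟨R₁ ∪ R₂, hsubI, hcard, ?_, fun h => (hpc h).elim, fun _ i hi => ?_⟩
          · rw [Finset.card_sdiff_of_subset hsubI]; omega
          · have hone' : ∃ R' ⊆ R₁ ∪ R₂, R'.card = e ∧ R' ⊆ P j \ A i := by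
              have hdis : ∀ {i' : ι} {R' : Finset W}, R' ⊆ A i' → IsIntegralIn A P i' j →
                  i' ≠ i → R' ⊆ P j \ A i := fun hR' hi' hne x hx =>
                mem_sdiff.2 ⟨hi'.2 (hR' hx), fun hxi =>
                  hne ((mem_clsOff.1 (hR' hx)).1.symm.trans (mem_clsOff.1 hxi).1)⟩
              by_cases hi1 : c v = i
              · exact ⟨R₂, subset_union_right, hR₂c, hdis hR₂ hw1 fun h => hwv (h.trans hi1.symm)⟩
              · exact ⟨R₁, subset_union_left, hR₁c, hdis hR₁ hv1 hi1⟩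
            obtain ⟨R', hR', hR'c, hR's⟩ := hone'
            have h1 := hsdiff i j j₀ ?_ hjj
            · calc ((P j \ (R₁ ∪ R₂)) \ A i).card ≤ ((P j \ A i) \ R').card := by
                    refine Finset.card_le_card fun x hx => ?_
                    simp only [mem_sdiff] at hx ⊢
                    exact ⟨⟨hx.1.1, hx.2⟩, fun h => hx.1.2 (hR' h)⟩
                _ ≤ y := by
                    rw [Finset.card_sdiff_of_subset hR's]
                    have : (I j₀).card = y := rfl
                    omega
            · obtain ⟨x, hx⟩ := hi.1
              exact ⟨x, mem_inter.2 ⟨hx, hi.2 hx⟩⟩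
        · push Not at hex
          refine ⟨∅, empty_subset _, by simp, by simpa using hj₀ j, fun h => (hpc h).elim,
            fun _ i hi => ?_⟩
          have : (P j \ ∅) \ A i = ∅ := by
            obtain ⟨x, hx⟩ := hi.1
            have hxi : i = c v := by rw [← hex x (hi.2 hx), (mem_clsOff.1 hx).1]
            refine Finset.eq_empty_of_forall_notMem fun z hz => ?_
            simp only [sdiff_empty, mem_sdiff] at hz
            exact hz.2 (mem_clsOff.2 ⟨hxi ▸ hex z hz.1, (mem_clsOff.1 hz.1).2⟩)
          rw [this]; simp
  choose R hRI hR2 hRy hRp hRn using hR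
  -- The parts of the partial classes of `c` that are deleted.
  have hQ : ∀ l, ∃ Q ⊆ A l, Q.card ≤ 2 * e ∧
      (Q.Nonempty → ∃ j, IsPartialIn A P l j) ∧ ∀ j, IsPartialIn A P l j →
        ((A l ∩ P j) \ Q).Nonempty ∧ ((A l ∩ P j) \ Q).card + 2 * e ≤ (A l).card ∧
        (A l \ Q).card + 2 * e ≤ (A l).card := by
    intro l
    by_cases hl : ∃ j, IsPartialIn A P l j
    · obtain ⟨j, hj⟩ := hl
      have hcov : (A l).card = ∑ x, (A l ∩ P x).card := by
        rw [Finset.card_eq_sum_card_fiberwise (f := p) (t := univ) (fun _ _ => mem_coe.2 (mem_univ _))]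
        refine Finset.sum_congr rfl fun x _ => congrArg _ ?_
        ext v
        simp only [mem_filter, mem_inter, hA, hP, mem_clsOff]
        tauto
      obtain ⟨x, -, hx⟩ := Finset.exists_max_image univ (fun x => (A l ∩ P x).card) univ_nonempty
      have hlarge : 2 * e < (A l ∩ P x).card := by
        have h1 := hbig l (hj.1.mono inter_subset_left)
        have h2 : ∑ x, (A l ∩ P x).card ≤ ∑ _x : Fin k, (A l ∩ P x).card :=
          Finset.sum_le_sum fun z hz => hx z hz
        simp only [sum_const, card_univ, Fintype.card_fin, smul_eq_mul] at h2
        have h3 : k * (2 * e) < k * (A l ∩ P x).card := by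
          calc k * (2 * e) = 2 * k * e := by ring
            _ < _ := h1
            _ ≤ _ := hcov ▸ h2
        exact lt_of_mul_lt_mul_left h3 (Nat.zero_le _)
      obtain ⟨Q, hQs, hQc⟩ := Finset.exists_subset_card_eq hlarge.le
      have hQA : Q ⊆ A l := hQs.trans inter_subset_left
      refine ⟨Q, hQA, hQc.le, fun _ => ⟨j, hj⟩, fun z hz => ?_⟩
      have hAQ : (A l \ Q).card + 2 * e ≤ (A l).card := by
        have := Finset.card_le_card hQA
        rw [Finset.card_sdiff_of_subset hQA]; omega
      refine ⟨?_, ?_, hAQ⟩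
      · by_cases hzx : z = x
        · subst hzx
          rw [← Finset.card_pos, Finset.card_sdiff_of_subset hQs]; omega
        · obtain ⟨v, hv⟩ := hz.1
          refine ⟨v, mem_sdiff.2 ⟨hv, fun hvQ => hzx ?_⟩⟩
          rw [← (mem_clsOff_inter.1 hv).2.1, (mem_clsOff_inter.1 (hQs hvQ)).2.1]
      · refine le_trans (Nat.add_le_add_right (Finset.card_le_card ?_) _) hAQ
        exact Finset.sdiff_subset_sdiff inter_subset_left subset_rfl
    · exact ⟨∅, empty_subset _, by simp, by simp, fun j hj => (hl ⟨j, hj⟩).elim⟩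
  choose Q hQA hQ2 hQn hQp using hQ
  set D := univ.biUnion R ∪ univ.biUnion Q with hD
  have hmemD : ∀ v, v ∈ D ↔ (∃ j, v ∈ R j) ∨ ∃ l, v ∈ Q l := fun v => by simp [hD]
  have hRmem : ∀ {v j}, v ∈ R j → IsIntegralIn A P (c v) j := fun hv =>
    (mem_integralPart.1 (hRI _ hv)).2
  have hQmem : ∀ {v l}, v ∈ Q l → c v = l ∧ ∃ j, IsPartialIn A P l j := fun {v l} hv =>
    ⟨(mem_clsOff.1 (hQA l hv)).1, hQn l ⟨v, hv⟩⟩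
  -- A deleted vertex of an integral class of `c` lies in the set `R j` of its own class.
  have hint : ∀ {v j}, IsIntegralIn A P (c v) j → (v ∈ D ↔ v ∈ R j) := by
    intro v j hv
    rw [hmemD]
    constructor
    · rintro (⟨j', hj'⟩ | ⟨l, hl⟩)
      · have h1 := (isIntegralIn_iff.1 hv).2 j' (isIntegralIn_iff.1 (hRmem hj')).1
        rwa [h1] at hj'
      · obtain ⟨rfl, j', hj'⟩ := hQmem hl
        exact (hv.not_isPartialIn hj').elim
    · exact fun h => Or.inl ⟨j, h⟩
  have hpar : ∀ {v j}, IsPartialIn A P (c v) j → (v ∈ D ↔ v ∈ Q (c v)) := by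
    intro v j hv
    rw [hmemD]
    constructor
    · rintro (⟨j', hj'⟩ | ⟨l, hl⟩)
      · exact ((hRmem hj').not_isPartialIn hv).elim
      · rwa [← (hQmem hl).1] at hl
    · exact fun h => Or.inr ⟨_, h⟩
  set A' := clsOff c (X ∪ D) with hA'
  set P' := clsOff p (X ∪ D) with hP'
  have hmA : ∀ i, A' i = A i \ D := fun i => by
    ext v; simp only [hA', hA, mem_sdiff, mem_clsOff, mem_union]; tauto
  have hmP : ∀ j, P' j = P j \ D := fun j => by
    ext v; simp only [hP', hP, mem_sdiff, mem_clsOff, mem_union]; tauto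
  have hmeet : ∀ i j, (A' i ∩ P' j).Nonempty ↔ (A i ∩ P j).Nonempty := by
    intro i j
    constructor
    · rintro ⟨v, hv⟩
      rw [hmA, hmP] at hv
      exact ⟨v, Finset.inter_subset_inter sdiff_subset sdiff_subset hv⟩
    · intro hne
      rcases isIntegralIn_or_isPartialIn hne with h | h
      · have hlt : (R j).card < (A i).card := by
          have h1 := hbig i h.1
          have h2 := hR2 j
          omega
        obtain ⟨v, hvA, hvR⟩ := Finset.exists_mem_notMem_of_card_lt_card hlt
        have hci : c v = i := (mem_clsOff.1 hvA).1
        have hvD : v ∉ D := fun hvD => hvR ((hint (hci ▸ h)).1 hvD)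
        refine ⟨v, ?_⟩
        rw [hmA, hmP]
        exact mem_inter.2
          ⟨mem_sdiff.2 ⟨hvA, hvD⟩, mem_sdiff.2 ⟨h.2 hvA, hvD⟩⟩
      · obtain ⟨v, hv⟩ := (hQp i j h).1
        obtain ⟨hv1, hvQ⟩ := mem_sdiff.1 hv
        have hci : c v = i := (mem_clsOff.1 (mem_inter.1 hv1).1).1
        have hvD : v ∉ D := fun hvD => hvQ (hci ▸ (hpar (hci ▸ h)).1 hvD)
        refine ⟨v, ?_⟩
        rw [hmA, hmP]
        exact mem_inter.2
          ⟨mem_sdiff.2 ⟨(mem_inter.1 hv1).1, hvD⟩, mem_sdiff.2 ⟨(mem_inter.1 hv1).2, hvD⟩⟩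
  have hI' : ∀ i j, IsIntegralIn A' P' i j ↔ IsIntegralIn A P i j := fun i j => by
    rw [hA', hP', isIntegralIn_iff, ← hA', ← hP', hA, hP, isIntegralIn_iff, ← hA, ← hP]
    simp only [hmeet]
  have hP'' : ∀ i j, IsPartialIn A' P' i j ↔ IsPartialIn A P i j := fun i j => by
    rw [hA', hP', isPartialIn_iff, ← hA', ← hP', hA, hP, isPartialIn_iff, ← hA, ← hP]
    simp only [hmeet]
  have hPC : ∀ j, IsPartialClass A' P' j ↔ IsPartialClass A P j := fun j =>
    exists_congr fun i => hP'' i j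
  have hII : ∀ j, integralPart A' P' j = I j \ R j := by
    intro j
    ext v
    rw [hA', hP', mem_integralPart, ← hA', ← hP', hI', mem_sdiff, hI, hA, hP, mem_integralPart,
      ← hA, ← hP, mem_union, not_or]
    constructor
    · rintro ⟨⟨h1, h2⟩, h3⟩
      exact ⟨⟨h1, h3⟩, fun h => h2 ((hint h3).2 h)⟩
    · rintro ⟨⟨h1, h3⟩, h2⟩
      exact ⟨⟨h1, fun h => h2 ((hint h3).1 h)⟩, h3⟩
  have hyI : ∀ j, y ≤ (integralPart A' P' j).card := fun j => by rw [hII]; exact hRy j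
  refine ⟨X ∪ D, subset_union_left, ?_, ⟨?_, ?_, ?_, ?_, ?_⟩, j₀, hyI⟩
  · refine (Finset.card_union_le _ _).trans (Nat.add_le_add_left ?_ _)
    refine (Finset.card_union_le _ _).trans ?_
    have h1 : (univ.biUnion R).card ≤ k * (2 * e) := by
      simpa using Finset.card_biUnion_le_card_mul univ R (2 * e) fun j _ => hR2 j
    have h2 : (univ.biUnion Q).card ≤ Fintype.card ι * (2 * e) := by
      simpa using Finset.card_biUnion_le_card_mul univ Q (2 * e) fun j _ => hQ2 j
    calc _ ≤ k * (2 * e) + Fintype.card ι * (2 * e) := Nat.add_le_add h1 h2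
      _ = _ := by ring
  · intro j i i' h h'
    exact hone j i i' ((hP'' _ _).1 h) ((hP'' _ _).1 h')
  · intro j j' hj hj'
    rw [hII, hII, (hRp j ((hPC j).1 hj)).1, (hRp j' ((hPC j').1 hj')).1]
  · intro j j' hj hj'
    have h1 : (integralPart A' P' j).card = y := by rw [hII, (hRp j ((hPC j).1 hj)).1]
    rw [h1]
    exact (hyI j').trans (Finset.card_le_card (integralPart_subset _ _ _))
  · intro i z j hi
    have hi' := (hP'' _ _).1 hi
    have h1 := (hQp i z hi').2.2
    have h2 := hpart i z j₀ hi'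
    have h3 : A' i ⊆ A i \ Q i := by
      rw [hmA]
      refine Finset.sdiff_subset_sdiff subset_rfl fun v hv => (hmemD v).2 (Or.inr ⟨i, hv⟩)
    have h4 := Finset.card_le_card h3
    refine le_trans ?_ (hyI j)
    change (A' i).card ≤ y
    have : (I j₀).card = y := rfl
    omega
  · intro i j j' hi _
    refine le_trans ?_ (hyI j')
    change (P' j \ A' i).card ≤ y
    have hi' := (hI' _ _).1 hi
    by_cases hpc : IsPartialClass A P j
    · obtain ⟨l, hl⟩ := hpc
      have hAI : A' i ⊆ integralPart A' P' j := subset_integralPart hi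
      have hsub : P' j \ A' i ⊆ (integralPart A' P' j \ A' i) ∪ ((A l ∩ P j) \ Q l) := by
        intro v hv
        obtain ⟨hvP, hvA⟩ := mem_sdiff.1 hv
        obtain ⟨hpv, hvX⟩ := mem_clsOff.1 hvP
        have hne : (A' (c v) ∩ P' j).Nonempty :=
          ⟨v, mem_inter.2 ⟨mem_clsOff.2 ⟨rfl, hvX⟩, hvP⟩⟩
        rcases isIntegralIn_or_isPartialIn hne with h | h
        · exact mem_union_left _ (mem_sdiff.2 ⟨mem_integralPart.2 ⟨hvX, h⟩, hvA⟩)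
        · have hvl := hone j _ _ ((hP'' _ _).1 h) hl
          rw [mem_union, not_or] at hvX
          refine mem_union_right _ (mem_sdiff.2 ⟨mem_clsOff_inter.2 ⟨hvl, hpv, hvX.1⟩, fun h => ?_⟩)
          exact hvX.2 ((hmemD v).2 (Or.inr ⟨l, h⟩))
      have h1 := (Finset.card_le_card hsub).trans (Finset.card_union_le _ _)
      have h2 : (integralPart A' P' j).card = y := by rw [hII, (hRp j ⟨l, hl⟩).1]
      have h2' := Finset.card_le_card hAI
      rw [Finset.card_sdiff_of_subset hAI, h2] at h1
      have h3 := (hQp l j hl).2.1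
      have h4 := hpi l i j hl hi'
      have h5 : (A i).card ≤ (A' i).card + e := by
        have h6 : A i \ R j ⊆ A' i := by
          rw [hmA]
          intro v hv
          obtain ⟨hvA, hvR⟩ := mem_sdiff.1 hv
          have hci : c v = i := (mem_clsOff.1 hvA).1
          exact mem_sdiff.2 ⟨hvA, fun hvD => hvR ((hint (hci ▸ hi')).1 hvD)⟩
        have h7 := Finset.card_le_card h6
        have h8 := Finset.le_card_sdiff (R j) (A i)
        have h9 := (hRp j ⟨l, hl⟩).2
        omega
      omega
    · refine le_trans (Finset.card_le_card ?_) (hRn j hpc i hi')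
      intro v hv
      rw [hmP, hmA] at hv
      simp only [mem_sdiff, not_and, not_not] at hv ⊢
      exact ⟨⟨hv.1.1, fun h => hv.1.2 ((hmemD v).2 (Or.inl ⟨j, h⟩))⟩, fun h => hv.1.2 (hv.2 h)⟩

end Cleaning

end Cleaning

/-! ### Stable partitions from labellings -/

section StableFromLabelling

theorem sum_filter_eq_card {ι W : Type*} [DecidableEq ι] [Fintype W] {c : W → ι} {b : ι → ℝ} {B : Finset ι}
    (hbc : ∀ i ∈ B, b i = (cls c i).card) (Q : ι → Prop) [DecidablePred Q] :
    ∑ i ∈ B with Q i, b i = ((univ.filter fun v => c v ∈ B ∧ Q (c v)).card : ℝ) := by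
  rw [Finset.card_eq_sum_card_fiberwise (f := c) (t := B.filter Q)
    (fun v hv => by simpa using hv), Nat.cast_sum]
  refine Finset.sum_congr rfl fun i hi => ?_
  obtain ⟨hiB, hQ⟩ := mem_filter.1 hi
  rw [hbc i hiB, cls, Finset.filter_filter]
  congr 2
  ext v
  simp only [mem_filter, mem_univ, true_and]
  exact ⟨fun h => ⟨h ▸ ⟨hiB, hQ⟩, h⟩, fun h => h.2⟩

section Labelling

variable {ι W : Type*} [Fintype ι] [DecidableEq ι] [Fintype W] [DecidableEq W] {k : ℕ}

set_option maxHeartbeats 400000 in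
/-- From a labelling of the vertices, as given by `exists_vertex_labelling`, to a stable partition:
besides the exceptional vertices, the vertices in small parts, those in many
exceptional pairs, and those in small intersections of a part with a class are deleted; what is left
is stable up to a small error. -/
theorem exists_isXStable_of_labelling {G : SimpleGraph W} {c : W → ι} {b : ι → ℝ} {B : Finset ι}
    {m : ℕ} {α θ : ℝ} {q : ι → Fin k} {p : W → Fin k} {X₀ : Finset W} {Z : Finset (W × W)}
    (hGc : G ≤ completeParts c)
    (hb : IsScaled b B k m α) (hbc : ∀ i ∈ B, b i = (cls c i).card) (hθ : 0 ≤ θ)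
    (hθα : 2 * θ < α) (hq : NearOpt b (2 * α * θ * m ^ 2) q)
    (hsingle : ∀ v, c v ∈ B → v ∉ X₀ →
      NearOpt b (2 * α * θ * m ^ 2) (Function.update q (c v) (p v)))
    (hpair : ∀ x y, c x ∈ B → c y ∈ B → c x ≠ c y → x ∉ X₀ → y ∉ X₀ → (x, y) ∉ Z →
      (G.Adj x y ↔ p x ≠ p y) ∧ NearOpt b (2 * α * θ * m ^ 2)
        (Function.update (Function.update q (c x) (p x)) (c y) (p y)))
    (hk : 0 < k) {β τ ε : ℝ} (hε : 0 < ε) (hβ : 0 < β) {e : ℕ}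
    (hZ : (Z.card : ℝ) < (β * m) ^ 2)
    (hX : ((univ.filter fun v => c v ∉ B).card : ℝ) + X₀.card + Z.card / (ε * m) +
      Fintype.card ι * k * (β * m) ≤ τ * m)
    (he : (3 * θ + τ) * m ≤ e) (hke : 2 * k * e < (α - τ) * m)
    (hXε : τ * m + 2 * e * (k + Fintype.card ι) ≤ ε * m) (hτε : θ + τ < ε) :
    ∃ X : Finset W, IsXStable G c p X ε m ∧ ∀ j, (1 - ε) * (m : ℝ) <
      ((integralPart (clsOff c X) (clsOff p X) j).card : ℝ) := by
  classical
  have hm := hb.m_pos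
  have hα := hb.α_le
  have hθ1 : θ ≤ 1 / 2 := by linarith
  have hεm : 0 < ε * m := mul_pos hε hm
  set Xz := univ.filter fun v => ε * m < ((univ.filter fun y => (v, y) ∈ Z).card : ℝ) with hXz
  set Xs := univ.filter fun v => c v ∉ B with hXs
  set X₁ := Xs ∪ X₀ ∪ Xz with hX₁
  set piece : ι → Fin k → Finset W := fun i j => univ.filter fun w =>
    (c w = i ∧ p w = j) ∧ w ∉ X₁ with hpiece
  set Xp := univ.filter fun v => v ∉ X₁ ∧ ((piece (c v) (p v)).card : ℝ) < β * m with hXp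
  set X := X₁ ∪ Xp with hXdef
  have hX₁s : ∀ v, v ∉ X₁ → c v ∈ B ∧ v ∉ X₀ ∧
      ((univ.filter fun y => (v, y) ∈ Z).card : ℝ) ≤ ε * m := fun v hv => by
    simp only [hX₁, hXs, hXz, mem_union, mem_filter, mem_univ, true_and, not_or, not_not,
      not_lt] at hv
    exact ⟨hv.1.1, hv.1.2, hv.2⟩
  have hXs' : ∀ v, v ∉ X → v ∉ X₁ ∧ β * m ≤ ((piece (c v) (p v)).card : ℝ) := fun v hv => by
    rw [hXdef, mem_union, not_or] at hv
    refine ⟨hv.1, not_lt.1 fun h => hv.2 (mem_filter.2 ⟨mem_univ _, hv.1, h⟩)⟩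
  have hXzc : (Xz.card : ℝ) ≤ Z.card / (ε * m) := by
    rw [le_div_iff₀ hεm, ← nsmul_eq_mul, ← Finset.sum_const,
      Finset.card_eq_sum_card_fiberwise (f := Prod.fst) (s := Z) (t := univ)
        (fun _ _ => mem_coe.2 (mem_univ _)), Nat.cast_sum]
    refine (Finset.sum_le_sum fun v hv => ?_).trans (Finset.sum_le_sum_of_subset_of_nonneg
      (subset_univ Xz) fun _ _ _ => Nat.cast_nonneg _)
    refine (mem_filter.1 hv).2.le.trans (Nat.cast_le.2 ?_)
    refine Finset.card_le_card_of_injOn (fun y => (v, y)) (fun y hy => ?_) fun y _ y' _ h =>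
      (Prod.mk.inj h).2
    simpa using hy
  have hXpc : (Xp.card : ℝ) ≤ Fintype.card ι * k * (β * m) := by
    rw [Finset.card_eq_sum_card_fiberwise (f := fun v => (c v, p v)) (t := univ)
      (fun _ _ => mem_coe.2 (mem_univ _)), Nat.cast_sum]
    refine (Finset.sum_le_card_nsmul _ _ (β * m) fun z _ => ?_).trans (le_of_eq (by simp))
    rcases (Xp.filter fun v => (c v, p v) = z).eq_empty_or_nonempty with h | ⟨v, hv⟩
    · rw [h]; simp; positivity
    · obtain ⟨hvX, rfl⟩ := mem_filter.1 hv
      refine le_trans (Nat.cast_le.2 (Finset.card_le_card fun w hw => ?_))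
        (mem_filter.1 hvX).2.2.le
      obtain ⟨hwX, hwz⟩ := mem_filter.1 hw
      exact mem_filter.2 ⟨mem_univ _, Prod.mk.inj hwz, (mem_filter.1 hwX).2.1⟩
  have hXc : (X.card : ℝ) ≤ τ * m := by
    refine le_trans ?_ hX
    have h1 : X.card ≤ Xs.card + X₀.card + Xz.card + Xp.card := by
      refine (Finset.card_union_le _ _).trans (Nat.add_le_add_right ?_ _)
      refine (Finset.card_union_le _ _).trans (Nat.add_le_add_right ?_ _)
      exact Finset.card_union_le _ _
    have h2 : (X.card : ℝ) ≤ Xs.card + X₀.card + Xz.card + Xp.card := by exact_mod_cast h1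
    linarith
  have hpieceS : ∀ {v w : W} , w ∈ piece (c v) (p v) → c w = c v ∧ p w = p v ∧ w ∉ X₁ :=
    fun hw => by
      have := (mem_filter.1 hw).2
      exact ⟨this.1.1, this.1.2, this.2⟩
  -- The class `q i` is allowed even if few vertices of the part `i` have this label: `q` itself has to
  -- be one of the partitions that are compared, and the bounds on the deleted sets survive.
  set S : ι → Finset (Fin k) := fun i => insert (q i) ((clsOff c X i).image p) with hS
  have hSswap : IsSwapOpt b (2 * α * θ * m ^ 2) B q S := by
    have hsing : ∀ i ∈ B, ∀ j ∈ S i, NearOpt b (2 * α * θ * m ^ 2) (Function.update q i j) := by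
      intro i hi j hj
      rcases mem_insert.1 hj with rfl | hj
      · rwa [Function.update_eq_self]
      · obtain ⟨v, hv, rfl⟩ := mem_image.1 hj
        obtain ⟨rfl, hvX⟩ := mem_clsOff.1 hv
        exact hsingle v hi (hX₁s v (hXs' v hvX).1).2.1
    refine ⟨fun i => mem_insert_self _ _, hq, hsing, ?_⟩
    intro i hi l hl hil j hj j' hj'
    rcases mem_insert.1 hj with rfl | hj₁
    · rw [Function.update_eq_self]; exact hsing l hl j' hj'
    rcases mem_insert.1 hj' with rfl | hj₂
    · rw [Function.update_comm hil, Function.update_eq_self]; exact hsing i hi j hj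
    obtain ⟨v, hv, rfl⟩ := mem_image.1 hj₁
    obtain ⟨w, hw, rfl⟩ := mem_image.1 hj₂
    obtain ⟨rfl, hvX⟩ := mem_clsOff.1 hv
    obtain ⟨rfl, hwX⟩ := mem_clsOff.1 hw
    -- Both labels occur on many vertices, so some pair with these labels is not exceptional.
    have hlt : Z.card < (piece (c v) (p v) ×ˢ piece (c w) (p w)).card := by
      rw [Finset.card_product, ← @Nat.cast_lt ℝ, Nat.cast_mul]
      refine hZ.trans_le ?_
      rw [sq]
      exact mul_le_mul (hXs' v hvX).2 (hXs' w hwX).2 (mul_pos hβ hm).le (Nat.cast_nonneg _)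
    obtain ⟨⟨x, y⟩, hxy, hxyZ⟩ := Finset.exists_mem_notMem_of_card_lt_card hlt
    obtain ⟨hx, hy⟩ := mem_product.1 hxy
    obtain ⟨hx1, hx2, hx3⟩ := hpieceS hx
    obtain ⟨hy1, hy2, hy3⟩ := hpieceS hy
    dsimp only at hx1 hx2 hx3 hy1 hy2 hy3
    have := (hpair x y (hx1 ▸ hi) (hy1 ▸ hl) (by rw [hx1, hy1]; exact hil) (hX₁s x hx3).2.1
      (hX₁s y hy3).2.1 hxyZ).2
    rwa [hx1, hx2, hy1, hy2] at this
  have hmemS : ∀ v, v ∉ X → c v ∈ B ∧ p v ∈ S (c v) := fun v hv =>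
    ⟨(hX₁s v (hXs' v hv).1).1, mem_insert_of_mem (mem_image_of_mem _ (mem_clsOff.2 ⟨rfl, hv⟩))⟩
  have hmeet : ∀ {i j}, (clsOff c X i ∩ clsOff p X j).Nonempty → i ∈ B ∧ j ∈ S i := by
    rintro i j ⟨v, hv⟩
    obtain ⟨rfl, rfl, hvX⟩ := mem_clsOff_inter.1 hv
    exact hmemS v hvX
  have hAne : ∀ {i}, (clsOff c X i).Nonempty → i ∈ B := by
    rintro i ⟨v, hv⟩
    obtain ⟨rfl, hvX⟩ := mem_clsOff.1 hv
    exact (hmemS v hvX).1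
  have hAle : ∀ i ∈ B, ((clsOff c X i).card : ℝ) ≤ b i := fun i hi => by
    rw [hbc i hi]
    exact_mod_cast Finset.card_le_card sdiff_subset
  have hAge : ∀ i ∈ B, b i - τ * m ≤ ((clsOff c X i).card : ℝ) := fun i hi => by
    have h1 := Finset.le_card_sdiff X (cls c i)
    have h2 : ((cls c i).card : ℝ) ≤ (clsOff c X i).card + X.card := by
      have : (cls c i).card ≤ (clsOff c X i).card + X.card := by rw [clsOff]; omega
      exact_mod_cast this
    rw [hbc i hi]; linarith
  have hI : ∀ j, innerWeight b B S j - τ * m ≤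
      ((integralPart (clsOff c X) (clsOff p X) j).card : ℝ) := fun j => by
    rw [innerWeight, sum_filter_eq_card hbc]
    have h1 : (univ.filter fun v => c v ∈ B ∧ S (c v) = {j}) \ X ⊆
        integralPart (clsOff c X) (clsOff p X) j := by
      intro v hv
      obtain ⟨hv1, hvX⟩ := mem_sdiff.1 hv
      obtain ⟨-, hvB, hvS⟩ := mem_filter.1 hv1
      refine mem_integralPart.2 ⟨hvX, ⟨v, mem_clsOff.2 ⟨rfl, hvX⟩⟩, fun w hw => ?_⟩
      obtain ⟨hwc, hwX⟩ := mem_clsOff.1 hw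
      have := (hmemS w hwX).2
      rw [hwc, hvS, mem_singleton] at this
      exact mem_clsOff.2 ⟨this, hwX⟩
    have h2 := Finset.card_le_card h1
    have h3 := Finset.le_card_sdiff X (univ.filter fun v => c v ∈ B ∧ S (c v) = {j})
    have h4 : ((univ.filter fun v => c v ∈ B ∧ S (c v) = {j}).card : ℝ) ≤
        (integralPart (clsOff c X) (clsOff p X) j).card + X.card := by
      have : (univ.filter fun v => c v ∈ B ∧ S (c v) = {j}).card ≤
        (integralPart (clsOff c X) (clsOff p X) j).card + X.card := by omega
      exact_mod_cast this
    linarith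
  have hT : ∀ i ∈ B, ∀ j ∈ S i,
      ((clsOff p X j \ clsOff c X i).card : ℝ) ≤ touchWeight b B S j - b i := by
    intro i hi j hj
    rw [touchWeight, sum_filter_eq_card hbc, hbc i hi, le_sub_iff_add_le]
    have hdis : Disjoint (clsOff p X j \ clsOff c X i) (cls c i) := by
      rw [Finset.disjoint_left]
      intro v hv hvi
      obtain ⟨hv1, hv2⟩ := mem_sdiff.1 hv
      exact hv2 (mem_sdiff.2 ⟨hvi, (mem_clsOff.1 hv1).2⟩)
    have h1 : (clsOff p X j \ clsOff c X i) ∪ cls c i ⊆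
        univ.filter fun v => c v ∈ B ∧ j ∈ S (c v) := by
      intro v hv
      refine mem_filter.2 ⟨mem_univ _, ?_⟩
      rcases mem_union.1 hv with hv | hv
      · obtain ⟨rfl, hvX⟩ := mem_clsOff.1 (mem_sdiff.1 hv).1
        exact hmemS v hvX
      · have : c v = i := by simpa [cls] using hv
        rw [this]; exact ⟨hi, hj⟩
    have h2 := Finset.card_le_card h1
    rw [Finset.card_union_of_disjoint hdis] at h2
    exact_mod_cast h2
  have hpar : ∀ {i j}, IsPartialIn (clsOff c X) (clsOff p X) i j →
      i ∈ B ∧ j ∈ S i ∧ ∃ x ∈ S i, x ≠ j := by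
    intro i j h
    obtain ⟨h1, x, h2, hx⟩ := isPartialIn_iff.1 h
    exact ⟨(hmeet h1).1, (hmeet h1).2, x, (hmeet h2).2, hx⟩
  have hclean := exists_isStable_of_almost c p X e hk
  obtain ⟨X', hXX', hX'c, hstable, j₀, hj₀⟩ := by
    refine hclean ?_ ?_ ?_ ?_ ?_
    · intro j i i' h h'
      obtain ⟨h1, h2, x, h3, h4⟩ := hpar h
      obtain ⟨h1', h2', x', h3', h4'⟩ := hpar h'
      exact hSswap.eq_of_partial hb hθ hθα h1 h1' h2 h2' h3 h4 h3' h4'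
    · intro i j j' h hjj
      obtain ⟨hi, hj⟩ := hmeet h
      have h1 := hT i hi j hj
      have h2 := hSswap.touchWeight_sub_le hb hθ hθα hi hj hjj.symm
      have h3 := hI j'
      have h4 := mul_nonneg hθ hm.le
      rw [← @Nat.cast_le ℝ, Nat.cast_add]
      linarith
    · intro l j j' h
      obtain ⟨hl, hj, x, hx, hxj⟩ := hpar h
      have h1 := hAle l hl
      have h2 := hSswap.le_innerWeight_of_partial hb hθ hθα hθ1 hl hj hx hxj j'
      have h3 := hI j'
      rw [← @Nat.cast_le ℝ, Nat.cast_add]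
      linarith
    · intro l i j h h'
      obtain ⟨hl, hj, x, hx, hxj⟩ := hpar h
      obtain ⟨hi, hji⟩ := hmeet (isIntegralIn_iff.1 h').1
      have h1 := hAle l hl
      have h2 := hSswap.le_of_partial hb hθ hθα hl hi hj hx hxj hji
      have h3 := hAge i hi
      have h4 := mul_nonneg hθ hm.le
      rw [← @Nat.cast_le ℝ, Nat.cast_add]
      linarith
    · intro i hne
      have hi := hAne hne
      have h1 := hAge i hi
      have h2 := hb.le i hi
      rw [← @Nat.cast_lt ℝ]
      push_cast
      linarith
  refine ⟨X', ⟨?_, ?_, hstable⟩, fun j => ?_⟩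
  · have h1 : (X'.card : ℝ) ≤ X.card + 2 * e * (k + Fintype.card ι) := by exact_mod_cast hX'c
    linarith
  · rintro ⟨v, hv⟩
    have hvX : v ∉ X := fun h => hv (hXX' h)
    obtain ⟨hvB, hv0, hvZ⟩ := hX₁s v (hXs' v hvX).1
    refine le_trans (Nat.cast_le.2 ?_) hvZ
    rw [← Set.ncard_coe_finset]
    refine Set.ncard_le_ncard_of_injOn Subtype.val ?_ Subtype.val_injective.injOn
      (Finset.finite_toSet _)
    rintro ⟨w, hw⟩ hvw
    have hwX : w ∉ X := fun h => hw (hXX' h)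
    obtain ⟨hwB, hw0, -⟩ := hX₁s w (hXs' w hwX).1
    simp only [mem_coe, mem_filter, mem_univ, true_and]
    by_contra hZ'
    have hiff : G.Adj v w ↔ (restrictToParts (completeParts c) p).Adj v w := by
      by_cases hc : c v = c w
      · exact iff_of_false (fun h => hGc h hc) (fun h => h.1 hc)
      · rw [(hpair v w hvB hwB hc hv0 hw0 hZ').1]
        exact ⟨fun h => ⟨hc, h⟩, fun h => h.2⟩
    rw [Set.mem_symmDiff] at hvw
    simp only [SimpleGraph.mem_neighborSet, SimpleGraph.comap_adj,
      Function.Embedding.subtype_apply] at hvw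
    tauto
  · have h1 : ((integralPart (clsOff c X) (clsOff p X) j₀).card : ℝ) ≤
        (integralPart (clsOff c X') (clsOff p X') j).card := by exact_mod_cast hj₀ j
    have h2 := hI j₀
    have h3 := hSswap.le_innerWeight hb hθ hθα j₀
    have h4 := mul_lt_mul_of_pos_right hτε hm
    linarith

end Labelling

end StableFromLabelling

/-! ### The optimum, the average over transversals, and gaps between part sizes -/

section OptimumAndAverage

section Optimum

theorem two_mul_crossSum {r s : ℕ} (n : Fin r → ℕ) (q : Fin r → Fin s) :
    2 * (crossSum n q : ℝ) = (∑ i, (n i : ℝ)) ^ 2 - sqWeight (fun i => (n i : ℝ)) q := by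
  set x : Fin s → ℝ := classWeight (fun i => (n i : ℝ)) q with hx
  have h1 : (crossSum n q : ℝ) = ∑ j, ∑ j' ∈ Finset.Ioi j, x j * x j' := by
    simp only [crossSum, Nat.cast_sum, Nat.cast_mul, hx, classWeight, cls, Finset.sum_filter,
      Nat.cast_ite, Nat.cast_zero]
  have h2 := Finset.sum_sum_Ioi_add_eq_sum_sum_off_diag fun j j' => x j * x j'
  have h3 : ∑ j, ∑ j' ∈ Finset.Ioi j, (x j' * x j + x j * x j') = 2 * (crossSum n q : ℝ) := by
    rw [h1, Finset.mul_sum]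
    refine Finset.sum_congr rfl fun j _ => ?_
    rw [Finset.mul_sum]
    exact Finset.sum_congr rfl fun j' _ => by ring
  have h4 : (∑ j, x j) ^ 2 = ∑ j, x j ^ 2 + ∑ i, ∑ j ∈ {i}ᶜ, x j * x i := by
    rw [sq, Finset.sum_mul_sum, ← Finset.sum_add_distrib]
    refine Finset.sum_congr rfl fun j _ => ?_
    rw [← Finset.sum_add_sum_compl {j} fun i => x j * x i, Finset.sum_singleton, sq]
    congr 1
    exact Finset.sum_congr rfl fun i _ => mul_comm _ _
  rw [← h3, h2, ← sum_eq_sum_classWeight _ q, ← hx, h4, sqWeight]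
  ring

/-- A partition that misses some of the classes can be improved until it uses all of them. -/
theorem exists_surjective_sqWeight_le {r k : ℕ} (hkr : k ≤ r) {b : Fin r → ℝ} (hb : ∀ i, 0 ≤ b i)
    (q : Fin r → Fin k) :
    ∃ q' : Fin r → Fin k, Function.Surjective q' ∧ sqWeight b q' ≤ sqWeight b q := by
  classical
  obtain ⟨q', hq', hmax⟩ := Finset.exists_max_image
    (univ.filter fun q' : Fin r → Fin k => sqWeight b q' ≤ sqWeight b q)
    (fun q' => (univ.image q').card) ⟨q, by simp⟩
  have hle := (mem_filter.1 hq').2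
  refine ⟨q', ?_, hle⟩
  by_contra hs
  rw [Function.Surjective] at hs
  push Not at hs
  obtain ⟨j, hj⟩ := hs
  have hninj : ¬ Function.Injective q' := fun hinj => by
    have hcard : Fintype.card (Fin r) = Fintype.card (Fin k) := by
      have := Fintype.card_le_of_injective q' hinj
      simp only [Fintype.card_fin] at this ⊢
      omega
    obtain ⟨i, hi⟩ := ((Fintype.bijective_iff_injective_and_card q').2 ⟨hinj, hcard⟩).2 j
    exact hj i hi
  rw [Function.Injective] at hninj
  push Not at hninj
  obtain ⟨i, l, hil, hne⟩ := hninj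
  have h0 : classWeight b q' j = 0 := Finset.sum_eq_zero fun a _ => if_neg (hj a)
  have h1 := sqWeight_update_sub b q' i (hj i).symm
  have h2 := single_le_classWeight hb q' i
  have h3 : 0 ≤ 2 * b i * (classWeight b q' (q' i) - b i - classWeight b q' j) :=
    mul_nonneg (mul_nonneg zero_le_two (hb i)) (by linarith)
  have h4 := hmax (Function.update q' i j) (mem_filter.2 ⟨mem_univ _, by linarith⟩)
  have h5 : insert j (univ.image q') ⊆ univ.image (Function.update q' i j) := by
    intro x hx
    rcases mem_insert.1 hx with rfl | hx
    · exact mem_image.2 ⟨i, mem_univ _, by simp⟩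
    · obtain ⟨a, -, rfl⟩ := mem_image.1 hx
      by_cases hai : a = i
      · exact mem_image.2 ⟨l, mem_univ _, by rw [Function.update_of_ne hne.symm, hai, hil]⟩
      · exact mem_image.2 ⟨a, mem_univ _, Function.update_of_ne hai _ _⟩
  have h6 := Finset.card_le_card h5
  rw [Finset.card_insert_of_notMem (by simpa using hj)] at h6
  omega

theorem sq_sub_sqWeight_le_two_mul_f {r t : ℕ} (hr : t - 1 ≤ r) (n : Fin r → ℕ)
    (q : Fin r → Fin (t - 1)) :
    (∑ i, (n i : ℝ)) ^ 2 - sqWeight (fun i => (n i : ℝ)) q ≤ 2 * (f n t : ℝ) := by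
  obtain ⟨q', hs, hle⟩ := exists_surjective_sqWeight_le hr (b := fun i => (n i : ℝ))
    (fun i => Nat.cast_nonneg _) q
  have h1 : crossSum n q' ≤ f n t := Finset.le_sup (f := crossSum n) (by simpa using hs)
  have h2 : (crossSum n q' : ℝ) ≤ f n t := by exact_mod_cast h1
  have h3 := two_mul_crossSum n q'
  linarith

end Optimum

section Average

variable {ι W : Type*} [Fintype ι] [DecidableEq ι] {k : ℕ}

/-- The edge weight of the graph induced by a random transversal is twice the number of edges on
average. -/
theorem sum_edgeWeight_comap [Fintype W] [DecidableEq W] {G : SimpleGraph W} [DecidableRel G.Adj]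
    {c : W → ι} (hGc : G ≤ completeParts c) {a : ι → ℝ} (ha : ∀ i, a i = (cls c i).card)
    (T : ι → Finset W) (hT : ∀ i, (cls c i).Nonempty → T i = cls c i) :
    ∑ u ∈ Fintype.piFinset T, edgeWeight a (G.comap u) =
      (Fintype.piFinset T).card * (2 * (G.edgeFinset.card : ℝ)) := by
  classical
  have hterm : ∀ i l, ∑ u ∈ Fintype.piFinset T, (if G.Adj (u i) (u l) then a i * a l else 0) =
      (Fintype.piFinset T).card *
        ∑ x ∈ cls c i, ∑ y ∈ cls c l, (if G.Adj x y then (1 : ℝ) else 0) := by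
    intro i l
    by_cases hil : i = l
    · subst hil
      rw [Finset.sum_eq_zero fun u _ => if_neg (G.loopless.irrefl _), Finset.sum_eq_zero, mul_zero]
      intro x hx
      refine Finset.sum_eq_zero fun y hy => if_neg fun h => hGc h ?_
      simp only [cls, mem_filter, mem_univ, true_and] at hx hy
      rw [hx, hy]
    rcases (cls c i).eq_empty_or_nonempty with hi | hi
    · have : a i = 0 := by rw [ha, hi]; simp
      simp [hi, this]
    rcases (cls c l).eq_empty_or_nonempty with hl | hl
    · have : a l = 0 := by rw [ha, hl]; simp
      simp [hl, this]
    rw [← hT i hi, ← hT l hl, ← card_mul_card_mul_sum_pair T _ hil, ha, ha, hT i hi, hT l hl,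
      Finset.mul_sum]
    refine Finset.sum_congr rfl fun u _ => ?_
    split_ifs <;> simp
  have hdeg : ∑ i, ∑ l, ∑ x ∈ cls c i, ∑ y ∈ cls c l, (if G.Adj x y then (1 : ℝ) else 0) =
      2 * (G.edgeFinset.card : ℝ) := by
    have h1 : ∀ g : W → ℝ, ∑ i, ∑ x ∈ cls c i, g x = ∑ x, g x := fun g =>
      Finset.sum_fiberwise univ c g
    calc _ = ∑ x, ∑ y, (if G.Adj x y then (1 : ℝ) else 0) := by
          rw [← h1]
          refine Finset.sum_congr rfl fun i _ => ?_
          rw [Finset.sum_comm]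
          exact Finset.sum_congr rfl fun x _ => h1 _
      _ = ∑ x, (G.degree x : ℝ) := by
          refine Finset.sum_congr rfl fun x _ => ?_
          rw [Finset.sum_boole, ← SimpleGraph.card_neighborFinset_eq_degree,
            SimpleGraph.neighborFinset_eq_filter]
      _ = _ := by exact_mod_cast G.sum_degrees_eq_twice_card_edges
  rw [← hdeg, Finset.mul_sum]
  simp only [edgeWeight, SimpleGraph.comap_adj]
  rw [Finset.sum_comm]
  refine Finset.sum_congr rfl fun i _ => ?_
  rw [Finset.sum_comm, Finset.mul_sum]
  exact Finset.sum_congr rfl fun l _ => hterm i l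

/-- Light parts can be neglected: if their total weight is `σ`, then giving them weight `0` increases
the defect by little, as they could all be put into one light class `j`. -/
theorem defect_le_of_restrict {G : SimpleGraph W} {a : ι → ℝ} (ha : ∀ i, 0 ≤ a i) (B : Finset ι)
    {b : ι → ℝ} (hb : ∀ i, b i = if i ∈ B then a i else 0) (q₀ : ι → Fin k) (j : Fin k)
    (u : ι → W) :
    defect b q₀ G u ≤ (∑ i, a i) ^ 2 - sqWeight a (fun i => if i ∈ B then q₀ i else j) -
      edgeWeight a (G.comap u) + (2 * (∑ i with i ∉ B, a i) * classWeight b q₀ j +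
        (∑ i with i ∉ B, a i) ^ 2) := by
  classical
  set σ := ∑ i with i ∉ B, a i with hσ
  have h1 : ∀ x, classWeight a (fun i => if i ∈ B then q₀ i else j) x =
      classWeight b q₀ x + if x = j then σ else 0 := by
    intro x
    have : (if x = j then σ else 0) = ∑ i, if x = j ∧ i ∉ B then a i else 0 := by
      by_cases hx : x = j <;> simp [hx, hσ, Finset.sum_filter]
    rw [this, classWeight, classWeight, ← Finset.sum_add_distrib]
    refine Finset.sum_congr rfl fun i _ => ?_
    by_cases hi : i ∈ B <;> simp [hb, hi, eq_comm]
  have h2 : sqWeight a (fun i => if i ∈ B then q₀ i else j) =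
      sqWeight b q₀ + (2 * σ * classWeight b q₀ j + σ ^ 2) := by
    rw [sqWeight, sqWeight, ← Finset.add_sum_erase _ _ (mem_univ j),
      ← Finset.add_sum_erase (s := univ) (a := j) (f := fun x => classWeight b q₀ x ^ 2)
        (mem_univ j), h1, if_pos rfl,
      Finset.sum_congr rfl fun x hx => by rw [h1, if_neg (ne_of_mem_erase hx), add_zero]]
    ring
  have h3 : (∑ i, b i) ^ 2 - edgeWeight b (G.comap u) ≤
      (∑ i, a i) ^ 2 - edgeWeight a (G.comap u) := by
    simp only [edgeWeight, sq, Finset.sum_mul_sum, ← Finset.sum_sub_distrib]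
    refine Finset.sum_le_sum fun i _ => Finset.sum_le_sum fun l _ => ?_
    have := mul_nonneg (ha i) (ha l)
    by_cases hi : i ∈ B <;> by_cases hl : l ∈ B <;>
      simp only [hb, hi, hl, if_true, if_false, zero_mul, mul_zero] <;> split_ifs <;> linarith
  rw [defect]
  linarith

end Average

/-- Of `r + 1` successive intervals `[g x, x)`, one contains none of `r` given numbers. -/
theorem exists_gap {r : ℕ} (g : ℝ → ℝ) (hg : ∀ x, 0 < x → x ≤ 1 → 0 < g x ∧ g x ≤ x)
    (x : Fin r → ℝ) : ∃ s ∈ Finset.range (r + 1), ∀ i, ¬ (g (g^[s] 1) ≤ x i ∧ x i < g^[s] 1) := by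
  have hpos : ∀ s, 0 < g^[s] 1 ∧ g^[s] 1 ≤ 1 := by
    intro s
    induction s with
    | zero => simp
    | succ s ih =>
      rw [Function.iterate_succ_apply']
      exact ⟨(hg _ ih.1 ih.2).1, (hg _ ih.1 ih.2).2.trans ih.2⟩
  have hanti : Antitone fun s => g^[s] 1 := antitone_nat_of_succ_le fun s => by
    rw [Function.iterate_succ_apply']
    exact (hg _ (hpos s).1 (hpos s).2).2
  by_contra! hcon
  have : ∀ s : Fin (r + 1), ∃ i, g (g^[s] 1) ≤ x i ∧ x i < g^[s] 1 := fun s =>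
    hcon s (Finset.mem_range.2 s.2)
  choose F hF using this
  have hlt : ∀ s s' : Fin (r + 1), s < s' → F s ≠ F s' := by
    intro s s' hss h
    have h1 := (hF s).1
    have h2 := (hF s').2
    have h3 : g^[(s' : ℕ)] 1 ≤ g^[(s : ℕ) + 1] 1 := hanti (Nat.succ_le_of_lt hss)
    rw [Function.iterate_succ_apply'] at h3
    rw [← h] at h2
    linarith
  have hinj : Function.Injective F := fun s s' h => by
    rcases lt_trichotomy s s' with h' | h' | h'
    · exact (hlt s s' h' h).elim
    · exact h'
    · exact (hlt s' s h' h.symm).elim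
  have := Fintype.card_le_of_injective F hinj
  simp at this

end OptimumAndAverage

/-! ### Choice of the constants -/

section Main

/-- The theorem for part sizes with a gap: no part has size between `α' * m` and `α * m`.  In
multiples of the appropriate power of `m`, the errors in the comparison of class sizes are of order
`τ`, intersections of a part with a class below `β` are deleted, `ρ` bounds the exceptional vertices
and pairs per pair of parts, and `η` bounds the average defect. -/
theorem exists_isXStable_of_gap {r k : ℕ} (hk : 0 < k) (hkr : k ≤ r) {W : Type*} [Fintype W]
    [DecidableEq W] {G : SimpleGraph W} [DecidableRel G.Adj] {c : W → Fin r} {n : Fin r → ℕ}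
    (hn : ∀ i, (cls c i).card = n i) (hanti : Antitone n) (hGc : G ≤ completeParts c)
    (hG : G.CliqueFree (k + 1)) {i₀ : Fin r} (hi₀ : (i₀ : ℕ) + 1 = k) {m : ℕ} (hm : n i₀ = m)
    {ε α α' τ β ρ η δ : ℝ} (hε : 0 < ε) (hε1 : ε < 1) (hα : 0 < α) (hα1 : α ≤ 1) (hα' : 0 < α')
    (hα'α : α' ≤ α)
    (hτ : 30 * r * τ = α * ε) (hβ : 4 * r ^ 2 * β = τ) (hρ : 8 * r ^ 2 * ρ = β ^ 2 * ε)
    (hη : (2 * r + 2) ^ 2 * (1 + r ^ 2) * η = 2 * α * τ * ρ) (hα'τ : 4 * r * α' ≤ τ)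
    (hα'η : 6 * r ^ 2 * α' ≤ η) (hδη : 4 * δ ≤ η) (hτm : 1 ≤ τ * m)
    (hopt : ∀ q : Fin r → Fin k, (∑ i, (n i : ℝ)) ^ 2 - sqWeight (fun i => (n i : ℝ)) q ≤
      2 * (G.edgeFinset.card : ℝ) + 2 * δ * m ^ 2)
    (hgap : ∀ i, ¬ (α' * m ≤ n i ∧ n i < α * m)) :
    ∃ (p : W → Fin k) (X : Finset W), IsXStable G c p X ε m ∧
      ∀ j, (1 - ε) * (m : ℝ) < ((integralPart (clsOff c X) (clsOff p X) j).card : ℝ) := by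
  classical
  have hr1 : (1 : ℝ) ≤ r := by exact_mod_cast (show 1 ≤ r by omega)
  have hkr' : (k : ℝ) ≤ r := by exact_mod_cast hkr
  have hrsq : (1 : ℝ) ≤ (r : ℝ) ^ 2 := one_le_pow₀ hr1
  have hrr : (r : ℝ) ≤ (r : ℝ) ^ 2 := le_self_pow₀ hr1 two_ne_zero
  have hτ0 : 0 < τ := by
    have : 0 < 30 * (r : ℝ) * τ := hτ ▸ mul_pos hα hε
    exact pos_of_mul_pos_right this (by positivity)
  have hβ0 : 0 < β := by
    have : 0 < 4 * (r : ℝ) ^ 2 * β := hβ ▸ hτ0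
    exact pos_of_mul_pos_right this (by positivity)
  have hρ0 : 0 < ρ := by
    have : 0 < 8 * (r : ℝ) ^ 2 * ρ := hρ ▸ mul_pos (pow_pos hβ0 2) hε
    exact pos_of_mul_pos_right this (by positivity)
  have hη0 : 0 < η := by
    have : 0 < (2 * (r : ℝ) + 2) ^ 2 * (1 + r ^ 2) * η := by rw [hη]; positivity
    exact pos_of_mul_pos_right this (by positivity)
  have hαε : α * ε ≤ α := mul_le_of_le_one_right hα.le hε1.le
  have hαε' : α * ε ≤ ε := mul_le_of_le_one_left hε.le hα1
  have hτr : τ ≤ r * τ := le_mul_of_one_le_left hτ0.le hr1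
  have hτ1 : τ ≤ 1 := by linarith
  have hβτ : 4 * β ≤ τ := by
    have := mul_le_mul_of_nonneg_right hrsq hβ0.le
    linarith
  have hm0 : (0 : ℝ) < m := pos_of_mul_pos_right (one_pos.trans_le hτm) hτ0.le
  have hmn : 0 < m := by exact_mod_cast hm0
  set a : Fin r → ℝ := fun i => (n i : ℝ) with ha
  set B : Finset (Fin r) := univ.filter fun i => α * m ≤ a i with hB
  set b : Fin r → ℝ := fun i => if i ∈ B then a i else 0 with hb
  have ha0 : ∀ i, 0 ≤ a i := fun i => Nat.cast_nonneg _
  have hba : ∀ i, b i ≤ a i := fun i => by simp only [hb]; split_ifs <;> simp [ha0]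
  have hscaled : IsScaled b B k (m : ℝ) α := by
    refine ⟨hm0, hα, hα1, fun i hi => if_neg hi, fun i hi => ?_, ?_, ?_⟩
    · simp only [hb, if_pos hi]; exact (mem_filter.1 hi).2
    · have hmem : ∀ i : Fin r, (i : ℕ) < k → (m : ℝ) ≤ a i := fun i hi => by
        have : n i₀ ≤ n i := hanti (Fin.le_def.2 (by omega))
        rw [hm] at this
        exact Nat.cast_le.2 this
      have hmemB : ∀ i : Fin r, (i : ℕ) < k → i ∈ B := fun i hi =>
        mem_filter.2 ⟨mem_univ _, le_trans (mul_le_of_le_one_left hm0.le hα1) (hmem i hi)⟩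
      refine ⟨univ.filter fun i : Fin r => (i : ℕ) < k, fun i hi => hmemB i (mem_filter.1 hi).2,
        ?_, fun i hi => ?_⟩
      · rw [Fin.card_filter_val_lt]; omega
      · simp only [hb, if_pos (hmemB i (mem_filter.1 hi).2)]
        exact hmem i (mem_filter.1 hi).2
    · refine ⟨univ.filter fun i : Fin r => (i : ℕ) < i₀, ?_, fun i hi => (hba i).trans ?_⟩
      · rw [Fin.card_filter_val_lt]; omega
      · simp only [mem_filter, mem_univ, true_and, not_lt] at hi
        have : n i ≤ n i₀ := hanti (Fin.le_def.2 hi)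
        rw [hm] at this
        exact Nat.cast_le.2 this
  have hbc : ∀ i ∈ B, b i = (cls c i).card := fun i hi => by simp [hb, hi, ha, hn]
  have hsmall : ∑ i with i ∉ B, a i ≤ r * (α' * m) := by
    refine (Finset.sum_le_card_nsmul _ _ (α' * m) fun i hi => ?_).trans ?_
    · have h1 : ¬ α * m ≤ a i := fun h => (mem_filter.1 hi).2 (mem_filter.2 ⟨mem_univ _, h⟩)
      by_contra h2
      exact hgap i ⟨(not_le.1 h2).le, not_le.1 h1⟩
    · rw [nsmul_eq_mul]
      refine mul_le_mul_of_nonneg_right ?_ (by positivity)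
      exact_mod_cast (Finset.card_le_univ _).trans (by simp)
  have hsmall0 : 0 ≤ ∑ i with i ∉ B, a i := Finset.sum_nonneg fun i _ => ha0 i
  have : Nonempty (Fin k) := ⟨⟨0, hk⟩⟩
  obtain ⟨q₀, -, hq₀⟩ := Finset.exists_min_image (univ : Finset (Fin r → Fin k))
    (fun q => sqWeight b q) univ_nonempty
  replace hq₀ : ∀ q, sqWeight b q₀ ≤ sqWeight b q := fun q => hq₀ q (mem_univ q)
  have hWne : Nonempty W := by
    have : 0 < (cls c i₀).card := by rw [hn, hm]; exact hmn
    exact ⟨(Finset.card_pos.1 this).choose⟩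
  -- Empty parts have weight `0`; their entry of a transversal is an arbitrary vertex.
  set T : Fin r → Finset W := fun i => if (cls c i).Nonempty then cls c i else univ with hT
  have hTne : ∀ i, (T i).Nonempty := fun i => by
    simp only [hT]
    split_ifs with h
    · exact h
    · exact univ_nonempty
  have hTc : ∀ i, (cls c i).Nonempty → T i = cls c i := fun i hi => if_pos hi
  have hTB : ∀ i ∈ B, T i = cls c i := fun i hi => hTc i <| by
    rw [← Finset.card_pos, ← @Nat.cast_pos ℝ, ← hbc i hi]
    exact hscaled.pos hi
  have havg : ∑ u ∈ Fintype.piFinset T, defect b q₀ G u ≤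
      (Fintype.piFinset T).card * (η * m ^ 2) := by
    obtain ⟨j, hj, -⟩ := hscaled.exists_light_class q₀
    rw [Fintype.card_fin] at hj
    have h1 := Finset.sum_le_sum fun u (_ : u ∈ Fintype.piFinset T) =>
      defect_le_of_restrict (G := G) ha0 B (b := b) (fun i => rfl) q₀ j u
    rw [Finset.sum_add_distrib, Finset.sum_sub_distrib, sum_edgeWeight_comap hGc
      (fun i => by rw [hn]) T hTc] at h1
    simp only [Finset.sum_const, nsmul_eq_mul] at h1
    refine h1.trans ?_
    rw [← mul_sub, ← mul_add]
    refine mul_le_mul_of_nonneg_left ?_ (Nat.cast_nonneg _)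
    have h2 := hopt fun i => if i ∈ B then q₀ i else j
    have h3 : (∑ i with i ∉ B, a i) * classWeight b q₀ j ≤ r * (α' * m) * (r * m) :=
      mul_le_mul hsmall hj (classWeight_nonneg hscaled.nonneg q₀ j) (by positivity)
    have h4 : (∑ i with i ∉ B, a i) ^ 2 ≤ (r * (α' * m)) ^ 2 :=
      pow_le_pow_left₀ hsmall0 hsmall 2
    have hm2 : 0 ≤ (m : ℝ) ^ 2 := by positivity
    have h5 : (r * (α' * m)) ^ 2 ≤ r * (α' * m) * (r * m) := by
      have : r * (α' * m) ≤ (r : ℝ) * m :=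
        mul_le_mul_of_nonneg_left (mul_le_of_le_one_left hm0.le (hα'α.trans hα1)) (by positivity)
      rw [sq]
      exact mul_le_mul_of_nonneg_left this (by positivity)
    have h6 := mul_le_mul_of_nonneg_right hα'η hm2
    have h7 := mul_le_mul_of_nonneg_right hδη hm2
    linarith
  have hrho : r ^ 2 * ρ * 8 ≤ β ^ 2 := by
    have : β ^ 2 * ε ≤ β ^ 2 := mul_le_of_le_one_right (by positivity) hε1.le
    linarith
  have hβ2 : β ^ 2 ≤ τ / 16 := by
    have := mul_le_mul (show β ≤ τ / 4 by linarith) (show β ≤ 1 / 4 by linarith) hβ0.le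
      (by positivity)
    linarith
  have hρr : r * ρ ≤ r ^ 2 * ρ := mul_le_mul_of_nonneg_right hrr hρ0.le
  have hρr' : ρ ≤ r * ρ := le_mul_of_one_le_left hρ0.le hr1
  have hρ1 : ρ ≤ 1 := by linarith
  have h2r : (1 : ℝ) ≤ 2 * r + 2 := by linarith
  have hηb : (2 * (r : ℝ) + 2) ^ 2 * ((1 + r ^ 2) * η) = 2 * α * τ * ρ := by rw [← hη]; ring
  have hη1 : (1 + (r : ℝ) ^ 2) * η ≤ 2 * α * τ * ρ := by
    rw [← hηb]
    exact le_mul_of_one_le_left (by positivity) (one_le_pow₀ h2r)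
  have hη2 : (2 * (r : ℝ) + 2) * ((1 + r ^ 2) * η) ≤ 2 * α * τ * ρ := by
    rw [← hηb]
    exact mul_le_mul_of_nonneg_right (le_self_pow₀ h2r two_ne_zero) (by positivity)
  have hατ : 2 * α * τ ≤ 1 := by
    have : α * τ ≤ τ := mul_le_of_le_one_left hτ0.le hα1
    linarith
  have hηρ : η ≤ ρ := by
    have h1 : η ≤ (1 + (r : ℝ) ^ 2) * η := le_mul_of_one_le_left hη0.le (by linarith)
    have h2 : 2 * α * τ * ρ ≤ ρ := mul_le_of_le_one_left hρ0.le hατ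
    linarith
  have h2τ : 2 * τ < α := by linarith
  have hm2 : (0 : ℝ) < (m : ℝ) ^ 2 := by positivity
  obtain ⟨q, p, X₀, Z, hq, hX₀, hZ, hsingle, hpair⟩ := exists_vertex_labelling hscaled hbc hG hq₀
    hTne hTB hτ0 h2τ (η := η * m ^ 2) (R := ρ * m ^ 2) (x₀ := ρ * m)
    (N := (2 * r + 2) * m) (by positivity) (by positivity) havg (by rw [Fintype.card_fin])
    (mul_le_mul_of_nonneg_right hηρ hm2.le)
    (by
      rw [Fintype.card_fin, ← mul_assoc]
      refine mul_le_mul_of_nonneg_right (hη1.trans ?_) hm2.le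
      exact mul_le_of_le_one_right (by positivity) hρ1)
    (by
      rw [Fintype.card_fin]
      calc (2 * (r : ℝ) + 2) * m * ((1 + r ^ 2) * (η * m ^ 2)) =
            (2 * r + 2) * ((1 + r ^ 2) * η) * m ^ 3 := by ring
        _ ≤ 2 * α * τ * ρ * m ^ 3 := mul_le_mul_of_nonneg_right hη2 (by positivity)
        _ = _ := by ring)
    (by
      rw [Fintype.card_fin]
      calc ((2 * (r : ℝ) + 2) * m) ^ 2 * ((1 + r ^ 2) * (η * m ^ 2)) =
            (2 * r + 2) ^ 2 * ((1 + r ^ 2) * η) * m ^ 4 := by ring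
        _ ≤ 2 * α * τ * ρ * m ^ 4 := mul_le_mul_of_nonneg_right hηb.le (by positivity)
        _ = _ := by ring)
  rw [Fintype.card_fin] at hX₀ hZ
  have hceil := Nat.ceil_lt_add_one (show 0 ≤ (3 * τ + τ) * (m : ℝ) by positivity)
  have he5 : (⌈(3 * τ + τ) * (m : ℝ)⌉₊ : ℝ) ≤ 5 * τ * m := by linarith
  refine ⟨p, exists_isXStable_of_labelling hGc hscaled hbc hτ0.le h2τ hq hsingle hpair hk hε hβ0
    (τ := τ) (e := ⌈(3 * τ + τ) * (m : ℝ)⌉₊) ?_ ?_ (Nat.le_ceil _) ?_ ?_ ?_⟩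
  · have : r ^ 2 * (ρ * m ^ 2) < (β * m) ^ 2 := by
      have h1 : r ^ 2 * ρ < β ^ 2 := by have := pow_pos hβ0 2; linarith
      have := mul_lt_mul_of_pos_right h1 hm2
      linarith
    exact hZ.trans_lt this
  · have h1 : ((univ.filter fun v => c v ∉ B).card : ℝ) ≤ r * (α' * m) := by
      refine le_trans (le_of_eq ?_) hsmall
      rw [Finset.card_eq_sum_card_fiberwise (f := c) (t := univ.filter fun i => i ∉ B)
        (fun v hv => by simpa using hv), Nat.cast_sum]
      refine Finset.sum_congr rfl fun i hi => ?_
      have hai : a i = (cls c i).card := by rw [hn]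
      rw [hai, cls, Finset.filter_filter]
      congr 2
      ext v
      simp only [mem_filter, mem_univ, true_and] at hi ⊢
      exact ⟨fun h => h.2, fun h => ⟨h ▸ hi, h⟩⟩
    have h2 : (Z.card : ℝ) / (ε * m) ≤ β ^ 2 / 8 * m := by
      rw [div_le_iff₀ (by positivity)]
      have : r ^ 2 * (ρ * m ^ 2) = β ^ 2 / 8 * m * (ε * m) := by
        have h : (r : ℝ) ^ 2 * ρ = β ^ 2 * ε / 8 := by linarith
        rw [← mul_assoc, h]; ring
      linarith
    have h3 : (Fintype.card (Fin r) : ℝ) * k * (β * m) ≤ τ / 4 * m := by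
      rw [Fintype.card_fin, ← mul_assoc]
      refine mul_le_mul_of_nonneg_right ?_ hm0.le
      have : (r : ℝ) * k * β ≤ r * r * β :=
        mul_le_mul_of_nonneg_right (mul_le_mul_of_nonneg_left hkr' (by positivity)) hβ0.le
      linarith
    have h4 : r * (α' * m) ≤ τ / 4 * m := by
      rw [← mul_assoc]
      exact mul_le_mul_of_nonneg_right (by linarith) hm0.le
    have h5 : β ^ 2 / 8 * m ≤ τ / 4 * m := mul_le_mul_of_nonneg_right (by linarith) hm0.le
    have h6 : r * (ρ * m) ≤ τ / 4 * m := by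
      rw [← mul_assoc]
      exact mul_le_mul_of_nonneg_right (by linarith) hm0.le
    linarith
  · have h1 : 2 * (k : ℝ) * ⌈(3 * τ + τ) * (m : ℝ)⌉₊ ≤ 2 * r * (5 * τ * m) :=
      mul_le_mul (by linarith) he5 (Nat.cast_nonneg _) (by positivity)
    have h2 : 10 * (r * τ) < α - τ := by linarith
    have h3 := mul_lt_mul_of_pos_right h2 hm0
    linarith
  · rw [Fintype.card_fin]
    have h1 : 2 * (⌈(3 * τ + τ) * (m : ℝ)⌉₊ : ℝ) * (k + r) ≤ 2 * (5 * τ * m) * (2 * r) :=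
      mul_le_mul (by linarith) (by linarith) (by positivity) (by positivity)
    have h2 : τ + 20 * (r * τ) ≤ ε := by linarith
    have h3 := mul_le_mul_of_nonneg_right h2 hm0.le
    linarith
  · linarith

end Main

end MultipartiteStability

theorem theorem4p1 (t r : ℕ) (ht : 2 ≤ t) (hr : t - 1 ≤ r) (ε : ℝ) (hε : 0 < ε) (hε1 : ε < 1) :
    ∃ δ : ℝ, 0 < δ ∧
      ∀ (W : Type*) [Fintype W] [DecidableEq W] (G : SimpleGraph W) [DecidableRel G.Adj]
        (c : W → Fin r) (n : Fin r → ℕ),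
        (∀ i, (MultipartiteStability.cls c i).card = n i) →
        Antitone n →
        G ≤ MultipartiteStability.completeParts c →
        G.CliqueFree t →
        1 / δ ≤ (n ⟨t - 2, by omega⟩ : ℝ) →
        (MultipartiteStability.f n t : ℝ) - δ * (n ⟨t - 2, by omega⟩ : ℝ) ^ 2
          ≤ (G.edgeFinset.card : ℝ) →
        ∃ (p : W → Fin (t - 1)) (X : Finset W),
          MultipartiteStability.IsXStable G c p X ε (n ⟨t - 2, by omega⟩) ∧
          ∀ j, (1 - ε) * (n ⟨t - 2, by omega⟩ : ℝ) <
            ((MultipartiteStability.integralPart (MultipartiteStability.clsOff c X)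
              (MultipartiteStability.clsOff p X) j).card : ℝ) := by
  have hr0 : (0 : ℝ) < r := by exact_mod_cast (show 0 < r by omega)
  have hr1 : (1 : ℝ) ≤ r := by exact_mod_cast (show 1 ≤ r by omega)
  set τ : ℝ → ℝ := fun α => α * ε / (30 * r) with hτ
  set β : ℝ → ℝ := fun α => τ α / (4 * r ^ 2) with hβ
  set ρ : ℝ → ℝ := fun α => β α ^ 2 * ε / (8 * r ^ 2) with hρ
  set η : ℝ → ℝ := fun α => 2 * α * τ α * ρ α / ((2 * r + 2) ^ 2 * (1 + r ^ 2)) with hη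
  -- `g α` is the lower end `α'` of a gap with upper end `α`, and `d α` is a suitable `δ` for it.
  set g : ℝ → ℝ := fun α => min (τ α / (4 * r)) (η α / (6 * r ^ 2)) with hg
  set d : ℝ → ℝ := fun α => min (τ α) (η α / 4) with hd
  have hτ0 : ∀ α, 0 < α → 0 < τ α := fun α hα => by simp only [hτ]; positivity
  have hβ0 : ∀ α, 0 < α → 0 < β α := fun α hα => by
    have := hτ0 α hα
    simp only [hβ]; positivity
  have hρ0 : ∀ α, 0 < α → 0 < ρ α := fun α hα => by
    have := hβ0 α hα
    simp only [hρ]; positivity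
  have hη0 : ∀ α, 0 < α → 0 < η α := fun α hα => by
    have := hτ0 α hα
    have := hρ0 α hα
    simp only [hη]; positivity
  have hgpos : ∀ α, 0 < α → α ≤ 1 → 0 < g α ∧ g α ≤ α := fun α hα _ => by
    have h1 := hτ0 α hα
    have h2 := hη0 α hα
    refine ⟨lt_min (by positivity) (by positivity), (min_le_left _ _).trans ?_⟩
    rw [div_le_iff₀ (by positivity)]
    have h3 : τ α ≤ α := by
      simp only [hτ]
      rw [div_le_iff₀ (by positivity)]
      have : ε ≤ 30 * r := by linarith
      exact mul_le_mul_of_nonneg_left this hα.le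
    nlinarith
  have hscale : ∀ s, 0 < g^[s] 1 ∧ g^[s] 1 ≤ 1 := by
    intro s
    induction s with
    | zero => simp
    | succ s ih =>
      rw [Function.iterate_succ_apply']
      exact ⟨(hgpos _ ih.1 ih.2).1, (hgpos _ ih.1 ih.2).2.trans ih.2⟩
  have hne : (Finset.range (r + 1)).Nonempty := Finset.nonempty_range_add_one
  refine ⟨(Finset.range (r + 1)).inf' hne fun s => d (g^[s] 1), ?_, ?_⟩
  · rw [Finset.lt_inf'_iff]
    intro s _
    exact lt_min (hτ0 _ (hscale s).1) (div_pos (hη0 _ (hscale s).1) (by norm_num))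
  intro W _ _ G _ c n hn hanti hGc hG hm hedges
  set δ := (Finset.range (r + 1)).inf' hne fun s => d (g^[s] 1) with hδ
  have hδ0 : 0 < δ := by
    rw [hδ, Finset.lt_inf'_iff]
    intro s _
    exact lt_min (hτ0 _ (hscale s).1) (div_pos (hη0 _ (hscale s).1) (by norm_num))
  set m := n ⟨t - 2, by omega⟩ with hmdef
  have hm0 : (0 : ℝ) < m := (one_div_pos.2 hδ0).trans_le hm
  obtain ⟨s, hs, hgap⟩ := MultipartiteStability.exists_gap g hgpos fun i => (n i : ℝ) / m
  obtain ⟨hα, hα1⟩ := hscale s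
  have hδd : δ ≤ d (g^[s] 1) := Finset.inf'_le _ hs
  set α := g^[s] 1 with hαdef
  have hδτ : δ ≤ τ α := hδd.trans (min_le_left _ _)
  have hδη : δ ≤ η α / 4 := hδd.trans (min_le_right _ _)
  refine MultipartiteStability.exists_isXStable_of_gap (k := t - 1) (by omega) hr hn hanti hGc
    (by rwa [Nat.sub_add_cancel (by omega)]) (i₀ := ⟨t - 2, by omega⟩)
    (show t - 2 + 1 = t - 1 by omega) rfl hε hε1 hα hα1
    (hgpos α hα hα1).1 (hgpos α hα hα1).2 (τ := τ α) (β := β α) (ρ := ρ α) (η := η α) (δ := δ)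
    ?_ ?_ ?_ ?_ ?_ ?_ ?_ ?_ ?_ ?_
  · simp only [hτ]; field_simp
  · simp only [hβ]; field_simp
  · simp only [hρ]; field_simp
  · simp only [hη]; field_simp
  · have := min_le_left (τ α / (4 * r)) (η α / (6 * r ^ 2))
    rw [le_div_iff₀ (by positivity)] at this
    linarith
  · have := min_le_right (τ α / (4 * r)) (η α / (6 * r ^ 2))
    rw [le_div_iff₀ (by positivity)] at this
    linarith
  · linarith
  · rw [div_le_iff₀ hδ0] at hm
    have := mul_le_mul_of_nonneg_left hδτ hm0.le
    linarith
  · intro q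
    have := MultipartiteStability.sq_sub_sqWeight_le_two_mul_f hr n q
    linarith
  · intro i hi
    refine hgap i ⟨?_, ?_⟩
    · rw [le_div_iff₀ hm0]; exact hi.1
    · rw [div_lt_iff₀ hm0]; exact hi.2
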